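/- Let $\Omega=[a,b]$ be a compact interval contained in an open interval $U\subseteq\mathbb R$, let $A_1,\dots,A_\kappa\in\mathbb C^{n\times n}$ be Hermitian, let $f_1,\dots,f_\kappa$ be real-valued functions that are real analytic on $U$, and put $\mathcal A(\omega)=\sum_{j=1}^{\kappa} f_j(\omega)A_j$ and $F(\omega)=\lambda_{\max}(\mathcal A(\omega))$. *Algorithm.* Let $\gamma<0$ satisfy $F''(\omega)\ge\gamma$ for all $\omega\in\Omega$ at which $F$ is differentiable. For a point $\omega^{(j)}$ at which $F$ is differentiable put $$q_j(\omega)=F(\omega^{(j)})+F'(\omega^{(j)})(\omega-\omega^{(j)})+\tfrac{\gamma}{2}(\omega-\omega^{(j)})^2 .$$ Starting from any $\omega^{(0)}\in\Omega$, the support based algorithm chooses, for $k=0,1,\dots$, a global minimizer $\omega^{(k+1)}$ over $\Omega$ of $\overline q_k=\max_{0\le j\le k}q_j$, and sets $\ell^{(k+1)}=\overline q_k(\omega^{(k+1)})$. It is understood that $F$ is differentiable at every iterate, so that all $q_j$ are defined. *Hypotheses.* $F$ has a unique global minimizer $\omega_*$ over $\Omega$; the eigenvalue $\lambda_*:=F(\omega_*)=\lambda_{\max}(\mathcal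 A(\omega_*))$ of $\mathcal A(\omega_*)$ has multiplicity at least $2$; and $0\in\operatorname{Int}\partial F(\omega_*)$, where $\partial F(\omega_*)$, the generalized Clarke derivative, is the convex hull of all limits $\lim_{k\to\infty}F'(x_k)$ along sequences $x_k\to\omega_*$ of points at which $F$ is differentiable. *Conclusions.* Let $\ell(k)$ be an index minimizing $\omega_*-\omega^{(j)}$ over all $j\in\{0,\dots,k\}$ with $\omega^{(j)}<\omega_*$, and let $r(k)$ be an index minimizing $\omega^{(j)}-\omega_*$ over all $j\in\{0,\dots,k\}$ with $\omega^{(j)}>\omega_*$ (whenever such $j$ exist). Then every pair of sequences $\{\omega^{(k)}\}$, $\{\ell^{(k)}\}$ generated by the algorithm satisfies the following. 1. For all sufficiently large $k$, $k\in\{\ell(k),r(k)\}$: the newest iterate is the closest one to $\omega_*$ on its side, and it is the only closest one. 2. $|\omega^{(k+1)}-\omega_*|=O\big(\max\{|\omega^{(k)}-\omega_*|,\,|\omega^{(k-1)}-\omega_*|\}^2\big)$ as $k\to\infty$. 3. If $|\gamma|$ is large enough, that is, at least some $\Gamma$ that depends only on the problem and not on the sequences generated, then $\lambda_*-\ell^{(k+1)}=O\big((\lambda_*-\ell^{(k-1)})^2\big)$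 as $k\to\infty$. -/

import Mathlib

open Filter Topology Asymptotics

noncomputable section

namespace EigOpt

/-- The largest eigenvalue of a Hermitian matrix: the largest real number in its spectrum. -/
def lamMax {n : ℕ} (M : Matrix (Fin n) (Fin n) ℂ) : ℝ := sSup (spectrum ℝ M)

/-- `lamMax M` is a multiple eigenvalue of `M`: its eigenspace has dimension at least two. -/
def LamMaxMultiple {n : ℕ} (M : Matrix (Fin n) (Fin n) ℂ) : Prop :=
  2 ≤ Module.finrank ℂ (Module.End.eigenspace (Matrix.toLin' M) ((lamMax M : ℝ) : ℂ))

/-- The matrix-valued function `𝒜(ω) = ∑ j, f j (ω) A j`. -/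
def family {n κ : ℕ} (f : Fin κ → ℝ → ℝ) (A : Fin κ → Matrix (Fin n) (Fin n) ℂ) (w : ℝ) :
    Matrix (Fin n) (Fin n) ℂ :=
  ∑ j, f j w • A j

/-- The objective `ω ↦ λ_max(𝒜(ω))`. -/
def objective {n κ : ℕ} (f : Fin κ → ℝ → ℝ) (A : Fin κ → Matrix (Fin n) (Fin n) ℂ) (w : ℝ) : ℝ :=
  lamMax (family f A w)

/-- The generalized (Clarke) derivative of a univariate function: the convex hull of all limits
of derivatives along sequences of points of differentiability that converge to `w`. -/
def clarkeDeriv (F : ℝ → ℝ) (w : ℝ) : Set ℝ :=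
  convexHull ℝ {v : ℝ | ∃ x : ℕ → ℝ, Tendsto x atTop (𝓝 w) ∧
    (∀ k, DifferentiableAt ℝ F (x k)) ∧ Tendsto (fun k => deriv F (x k)) atTop (𝓝 v)}

/-- The quadratic support function of `F` about `w` with curvature `γ`. -/
def support (F : ℝ → ℝ) (γ w x : ℝ) : ℝ :=
  F w + deriv F w * (x - w) + γ / 2 * (x - w) ^ 2

/-- The piecewise quadratic model `max_{j = 0, …, k} q_j`, where `q_j` is the support function
about `ω j`. -/
def model (F : ℝ → ℝ) (γ : ℝ) (ω : ℕ → ℝ) (k : ℕ) (x : ℝ) : ℝ :=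
  (Finset.range (k + 1)).sup' ⟨0, Finset.mem_range.2 k.succ_pos⟩ (fun j => support F γ (ω j) x)

/-- `γ` is a negative lower bound for `F''` at all points of `Ω` where `F` is differentiable. -/
def IsCurvatureBound (F : ℝ → ℝ) (Ω : Set ℝ) (γ : ℝ) : Prop :=
  γ < 0 ∧ ∀ x ∈ Ω, DifferentiableAt ℝ F x → γ ≤ deriv (deriv F) x

/-- `ω` and `l` are sequences of iterates and of lower bounds generated by the support based
algorithm on `Ω` (any starting point, any choice among several global minimizers of the model).
The algorithm forms the support function about every iterate, so `F` has to be differentiable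
there. The algorithm produces `l k` for `k ≥ 1` only; `l 0` is arbitrary. -/
structure IsRun (F : ℝ → ℝ) (Ω : Set ℝ) (γ : ℝ) (ω l : ℕ → ℝ) : Prop where
  mem : ∀ k, ω k ∈ Ω
  differentiable : ∀ k, DifferentiableAt ℝ F (ω k)
  isMin : ∀ k, IsMinOn (model F γ ω k) Ω (ω (k + 1))
  lower : ∀ k, l (k + 1) = model F γ ω k (ω (k + 1))

/-- `j` attains `min {w - ω i | i ∈ {0, …, k}, ω i < w}`: among the first iterates up to `k`,
`ω j` is a closest one to `w` on the left of `w`. -/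
def IsLeftNearest (ω : ℕ → ℝ) (w : ℝ) (k j : ℕ) : Prop :=
  j ≤ k ∧ ω j < w ∧ ∀ i ≤ k, ω i < w → w - ω j ≤ w - ω i

/-- `j` attains `min {ω i - w | i ∈ {0, …, k}, w < ω i}`: among the first iterates up to `k`,
`ω j` is a closest one to `w` on the right of `w`. -/
def IsRightNearest (ω : ℕ → ℝ) (w : ℝ) (k j : ℕ) : Prop :=
  j ≤ k ∧ w < ω j ∧ ∀ i ≤ k, w < ω i → ω j - w ≤ ω i - w

end EigOpt

end

/-! Write `F` for `objective f A`. Along an analytic Hermitian family, `F` is analytic on each side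
of every point (Rellich, `hasAnalyticTopRoot`). The Rayleigh quotient of a fixed top eigenvector is
a differentiable minorant touching `F` (`exists_minorant`), so kinks can only be convex. Together
with the curvature bound this makes `F x - γ / 2 * x ^ 2` convex (`convexOn_sub_sq`). Hence all
support functions lie below `F`, the bounds `l (k + 1)` stay below `F w`, and the iterates converge
to `w` (`IsRun.tendsto`).

The Clarke condition says that the one-sided slopes at `w` are `-α < 0 < β` (`exists_kink`). By
convexity, support functions about points right of `w` increase near `w` at a rate at least some `c
> 0`, and those about points left of `w` decrease at such a rate. One-sided analyticity makes them
accurate at `w` up to `C * (ω j - w) ^ 2`. `IsSharpAt` isolates these facts. A model minimizer near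
`w` must have an active support function from the other side (`exists_active`), which leads to `F w
- C * max(|ω (k+1) - w|, |ω k - w|)² + c * |ω (k+2) - w| ≤ l (k+2) ≤ F w` (`add_mul_abs_le_lower`).
This gives the quadratic bound on the errors, and with `c * |ω (k+1) - w| ≤ F w - l (k+1)` also the
one on the gaps. Finally, a support function about a nearby `ω j` exceeds `F w` from `ω j` outwards,
so no new iterate near `w` lands there (`lt_of_same_side`). -/

namespace EigOpt

/-! ### Polynomials with analytic coefficients -/

section

open Polynomial

/-- A family of polynomials all of whose coefficients depend analytically on the parameter. -/
def CoeffAnalyticAt {V K : Type*} [NormedAddCommGroup V] [NormedSpace ℝ V] [NormedField K]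
    [NormedAlgebra ℝ K] (p : V → K[X]) (x₀ : V) : Prop :=
  ∀ i, AnalyticAt ℝ (fun x => (p x).coeff i) x₀

namespace CoeffAnalyticAt

variable {V K ι : Type*} [NormedAddCommGroup V] [NormedSpace ℝ V] [NormedField K]
    [NormedAlgebra ℝ K] {p q : V → K[X]} {x₀ : V}

theorem const (P : K[X]) : CoeffAnalyticAt (fun _ : V => P) x₀ := fun _ => analyticAt_const

theorem add (hp : CoeffAnalyticAt p x₀) (hq : CoeffAnalyticAt q x₀) :
    CoeffAnalyticAt (fun x => p x + q x) x₀ := fun i => by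
  simpa only [coeff_add] using (hp i).fun_add (hq i)

theorem mul (hp : CoeffAnalyticAt p x₀) (hq : CoeffAnalyticAt q x₀) :
    CoeffAnalyticAt (fun x => p x * q x) x₀ := fun i => by
  simp only [coeff_mul]
  exact Finset.analyticAt_fun_sum _ fun n _ => (hp n.1).fun_mul (hq n.2)

theorem sum {s : Finset ι} {p : ι → V → K[X]} (hp : ∀ j ∈ s, CoeffAnalyticAt (p j) x₀) :
    CoeffAnalyticAt (fun x => ∑ j ∈ s, p j x) x₀ := fun i => by
  simp only [finsetSum_coeff]
  exact Finset.analyticAt_fun_sum _ fun n hn => hp n hn i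

theorem prod {s : Finset ι} {p : ι → V → K[X]} (hp : ∀ j ∈ s, CoeffAnalyticAt (p j) x₀) :
    CoeffAnalyticAt (fun x => ∏ j ∈ s, p j x) x₀ := by
  classical
  induction s using Finset.induction_on with
  | empty => simpa using const (V := V) (x₀ := x₀) (1 : K[X])
  | insert j s hj ih =>
    simp only [Finset.prod_insert hj]
    exact (hp j (Finset.mem_insert_self _ _)).mul
      (ih fun i hi => hp i (Finset.mem_insert_of_mem hi))

theorem C {a : V → K} (ha : AnalyticAt ℝ a x₀) : CoeffAnalyticAt (fun x => C (a x)) x₀ :=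
  fun i => by
    simp only [coeff_C]
    split_ifs
    exacts [ha, analyticAt_const]

theorem eval {n : ℕ} (hp : CoeffAnalyticAt p x₀) (hn : ∀ x, (p x).natDegree ≤ n) {r : V → K}
    (hr : AnalyticAt ℝ r x₀) : AnalyticAt ℝ (fun x => (p x).eval (r x)) x₀ := by
  have : (fun x => (p x).eval (r x)) =
      fun x => ∑ i ∈ Finset.range (n + 1), (p x).coeff i * r x ^ i := by
    funext x
    exact eval_eq_sum_range' (Nat.lt_succ_of_le (hn x)) _
  rw [this]
  exact Finset.analyticAt_fun_sum _ fun i _ => (hp i).fun_mul (hr.fun_pow i)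

theorem continuousAt_eval {n : ℕ} (hp : CoeffAnalyticAt p x₀) (hn : ∀ x, (p x).natDegree ≤ n)
    (r : K) : ContinuousAt (fun z : V × K => (p z.1).eval z.2) (x₀, r) := by
  have : (fun z : V × K => (p z.1).eval z.2) =
      fun z => ∑ i ∈ Finset.range (n + 1), (p z.1).coeff i * z.2 ^ i := by
    funext z
    exact eval_eq_sum_range' (Nat.lt_succ_of_le (hn z.1)) _
  rw [this]
  refine tendsto_finsetSum _ fun i _ => ?_
  exact (ContinuousAt.comp (f := Prod.fst) (x := (x₀, r)) (hp i).continuousAt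
    continuousAt_fst).mul (continuousAt_snd.pow i)

/-- Roots stay away from a compact set that contains no root of the limit polynomial. -/
theorem eventually_eval_ne_zero {n : ℕ} (hp : CoeffAnalyticAt p x₀)
    (hn : ∀ x, (p x).natDegree ≤ n) {S : Set K} (hS : IsCompact S)
    (h : ∀ r ∈ S, (p x₀).eval r ≠ 0) : ∀ᶠ x in 𝓝 x₀, ∀ r ∈ S, (p x).eval r ≠ 0 := by
  refine hS.eventually_forall_of_forall_eventually fun r hr => ?_
  exact (hp.continuousAt_eval hn r).eventually_ne (h r hr)

/-- The roots of a monic family are locally uniformly bounded. -/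
theorem exists_root_bound {n : ℕ} (hp : CoeffAnalyticAt p x₀)
    (hm : ∀ x, (p x).Monic ∧ (p x).natDegree = n) :
    ∃ M : ℝ, ∀ᶠ x in 𝓝 x₀, ∀ r, (p x).IsRoot r → ‖r‖ ≤ M := by
  -- `S + 1` dominates Cauchy's bound for a monic polynomial: one plus the largest norm of a lower
  -- coefficient.
  set S : ℝ := ∑ i ∈ Finset.range n, (‖(p x₀).coeff i‖ + 1)
  refine ⟨S + 1, ?_⟩
  have hev : ∀ᶠ x in 𝓝 x₀, ∀ i ∈ Finset.range n, ‖(p x).coeff i‖ < ‖(p x₀).coeff i‖ + 1 :=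
    (Finset.eventually_all _).2 fun i _ =>
      (hp i).continuousAt.norm.eventually_lt_const (lt_add_one _)
  filter_upwards [hev] with x hx r hr
  refine ((NNReal.coe_lt_coe.2 (hr.norm_lt_cauchyBound (hm x).1.ne_zero)).le).trans ?_
  simp only [cauchyBound, (hm x).1.leadingCoeff, nnnorm_one, div_one, (hm x).2, NNReal.coe_add,
    NNReal.coe_one, add_le_add_iff_right]
  have hS : 0 ≤ S := Finset.sum_nonneg fun i _ => by positivity
  lift S to NNReal using hS with S' hS'
  rw [NNReal.coe_le_coe]
  refine Finset.sup_le fun i hi => ?_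
  rw [← NNReal.coe_le_coe, coe_nnnorm, hS']
  exact (hx i hi).le.trans (Finset.single_le_sum (f := fun i => ‖(p x₀).coeff i‖ + 1)
    (fun i _ => by positivity) hi)

end CoeffAnalyticAt

end

/-! ### Analytic factorization by the inverse function theorem -/

section

open Polynomial

/-- The polynomial of degree less than `k` with prescribed coefficients. -/
noncomputable def ofCoeffs {k : ℕ} (u : Fin k → ℝ) : ℝ[X] := ∑ i, C (u i) * X ^ (i : ℕ)

theorem degree_ofCoeffs_lt {k : ℕ} (u : Fin k → ℝ) : (ofCoeffs u).degree < k :=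
  degree_sum_fin_lt u

theorem coeff_ofCoeffs {k : ℕ} (u : Fin k → ℝ) (i : Fin k) : (ofCoeffs u).coeff i = u i := by
  simp [ofCoeffs, finsetSum_coeff, coeff_C_mul, coeff_X_pow, Fin.val_inj]

theorem ofCoeffs_eq_zero {k : ℕ} {u : Fin k → ℝ} (h : ofCoeffs u = 0) : u = 0 := by
  funext i
  rw [← coeff_ofCoeffs u, h, coeff_zero, Pi.zero_apply]

theorem ofCoeffs_smul {k : ℕ} (t : ℝ) (u : Fin k → ℝ) : ofCoeffs (t • u) = C t * ofCoeffs u := by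
  simp [ofCoeffs, Finset.mul_sum, mul_assoc]

theorem coeffAnalyticAt_ofCoeffs {V : Type*} [NormedAddCommGroup V] [NormedSpace ℝ V] {k : ℕ}
    {u : V → Fin k → ℝ} {x₀ : V} (hu : AnalyticAt ℝ u x₀) :
    CoeffAnalyticAt (fun x => ofCoeffs (u x)) x₀ :=
  CoeffAnalyticAt.sum fun i _ =>
    (CoeffAnalyticAt.C (analyticAt_pi_iff.1 hu i)).mul (CoeffAnalyticAt.const _)

theorem monic_add_ofCoeffs {k : ℕ} {P : ℝ[X]} (hP : P.Monic) (hk : P.natDegree = k)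
    (u : Fin k → ℝ) : (P + ofCoeffs u).Monic ∧ (P + ofCoeffs u).natDegree = k := by
  have h : (ofCoeffs u).degree < P.degree := by
    rw [degree_eq_natDegree hP.ne_zero, hk]
    exact degree_ofCoeffs_lt u
  exact ⟨hP.add_of_left h, by rw [natDegree_add_eq_left_of_degree_lt h, hk]⟩

/-- Multiplication of perturbations of two monic polynomials, in coordinates. -/
noncomputable def mulCoeffs {k m : ℕ} (P Q : ℝ[X]) (z : (Fin k → ℝ) × (Fin m → ℝ))
    (i : Fin (k + m)) : ℝ :=
  ((P + ofCoeffs z.1) * (Q + ofCoeffs z.2)).coeff i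

theorem analyticAt_mulCoeffs {k m : ℕ} (P Q : ℝ[X]) (z : (Fin k → ℝ) × (Fin m → ℝ)) :
    AnalyticAt ℝ (mulCoeffs P Q) z := by
  refine analyticAt_pi_iff.2 fun i => ?_
  exact (((CoeffAnalyticAt.const P).add (coeffAnalyticAt_ofCoeffs analyticAt_fst)).mul
    ((CoeffAnalyticAt.const Q).add (coeffAnalyticAt_ofCoeffs analyticAt_snd))) i

theorem eq_zero_of_mul_add_mul_eq_zero {k m : ℕ} {P Q : ℝ[X]} (hP : P.Monic)
    (hk : P.natDegree = k) (hPQ : IsCoprime P Q)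
    {u : Fin k → ℝ} {v : Fin m → ℝ} (h : P * ofCoeffs v + ofCoeffs u * Q = 0) :
    u = 0 ∧ v = 0 := by
  have hu : ofCoeffs u = 0 := by
    have : P ∣ ofCoeffs u := hPQ.dvd_of_dvd_mul_right
      ⟨-ofCoeffs v, by linear_combination h⟩
    refine eq_zero_of_dvd_of_degree_lt this ?_
    rw [degree_eq_natDegree hP.ne_zero, hk]
    exact degree_ofCoeffs_lt u
  have hv : ofCoeffs v = 0 := by
    rw [hu, zero_mul, add_zero] at h
    exact (mul_eq_zero.1 h).resolve_left hP.ne_zero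
  exact ⟨ofCoeffs_eq_zero hu, ofCoeffs_eq_zero hv⟩

/-- The derivative at `0` in direction `(u, v)` is the Sylvester map `P * v + u * Q`, whose kernel
is trivial for coprime `P`, `Q` by degree reasons. -/
theorem fderiv_mulCoeffs_injective {k m : ℕ} {P Q : ℝ[X]} (hP : P.Monic) (hQ : Q.Monic)
    (hk : P.natDegree = k) (hm : Q.natDegree = m) (hPQ : IsCoprime P Q) :
    Function.Injective (fderiv ℝ (mulCoeffs (k := k) (m := m) P Q) 0) := by
  refine (injective_iff_map_eq_zero _).2 fun z hz => ?_
  set R := P * ofCoeffs z.2 + ofCoeffs z.1 * Q with hR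
  have hline : HasDerivAt (fun t : ℝ => mulCoeffs P Q (t • z)) 0 0 := by
    have h1 : HasFDerivAt (mulCoeffs (k := k) (m := m) P Q) (fderiv ℝ (mulCoeffs P Q) 0)
        ((0 : ℝ) • z) := by
      rw [zero_smul]
      exact (analyticAt_mulCoeffs P Q 0).differentiableAt.hasFDerivAt
    have h2 : HasDerivAt (fun t : ℝ => t • z) ((1 : ℝ) • z) 0 := (hasDerivAt_id _).smul_const z
    have := h1.comp_hasDerivAt (0 : ℝ) h2
    rwa [one_smul, hz] at this
  have hcoeff : ∀ i : Fin (k + m), R.coeff i = 0 := by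
    intro i
    have h1 := (hasDerivAt_pi.1 hline) i
    -- On the line `t • z` the product is quadratic in `t`, with linear coefficient `R`.
    have h2 : (fun t : ℝ => mulCoeffs P Q (t • z) i) = fun t =>
        (P * Q).coeff i + t * R.coeff i + t ^ 2 * (ofCoeffs z.1 * ofCoeffs z.2).coeff i := by
      funext t
      have : (P + C t * ofCoeffs z.1) * (Q + C t * ofCoeffs z.2) =
          P * Q + C t * R + C (t ^ 2) * (ofCoeffs z.1 * ofCoeffs z.2) := by
        rw [hR, C_pow]; ring
      simp only [mulCoeffs, Prod.smul_fst, Prod.smul_snd, ofCoeffs_smul, this, coeff_add,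
        coeff_C_mul]
    rw [h2] at h1
    have h3 : HasDerivAt (fun t : ℝ => (P * Q).coeff i + t * R.coeff i +
        t ^ 2 * (ofCoeffs z.1 * ofCoeffs z.2).coeff i) (R.coeff i) 0 := by
      have := (((hasDerivAt_id (0 : ℝ)).mul_const (R.coeff i)).const_add ((P * Q).coeff i)).add
        (((hasDerivAt_id (0 : ℝ)).pow 2).mul_const ((ofCoeffs z.1 * ofCoeffs z.2).coeff i))
      convert! this using 1
      simp
    exact h3.unique h1
  have hdeg : R.degree < ((k + m : ℕ) : WithBot ℕ) := by
    refine (degree_add_le _ _).trans_lt (max_lt ?_ ?_)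
    · rw [mul_comm, hP.degree_mul, degree_eq_natDegree hP.ne_zero, hk, Nat.cast_add,
        add_comm (k : WithBot ℕ)]
      exact WithBot.add_lt_add_right (by simp) (degree_ofCoeffs_lt _)
    · rw [hQ.degree_mul, degree_eq_natDegree hQ.ne_zero, hm, Nat.cast_add]
      exact WithBot.add_lt_add_right (by simp) (degree_ofCoeffs_lt _)
  have hR0 : R = 0 := by
    ext i
    rw [coeff_zero]
    by_cases hi : i < k + m
    · exact hcoeff ⟨i, hi⟩
    · exact coeff_eq_zero_of_degree_lt (hdeg.trans_le (by exact_mod_cast not_lt.1 hi))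
  obtain ⟨h1, h2⟩ := eq_zero_of_mul_add_mul_eq_zero hP hk hPQ (hR ▸ hR0)
  exact Prod.ext h1 h2

/-- An analytic family of monic polynomials factors analytically along a factorization of one
member into coprime monic factors. -/
theorem exists_factor_family {V : Type*} [NormedAddCommGroup V] [NormedSpace ℝ V] {k m : ℕ}
    {p : V → ℝ[X]} {x₀ : V}
    (hp : CoeffAnalyticAt p x₀) (hpm : ∀ x, (p x).Monic ∧ (p x).natDegree = k + m)
    {P Q : ℝ[X]} (hP : P.Monic) (hQ : Q.Monic) (hk : P.natDegree = k) (hm : Q.natDegree = m)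
    (hPQ : IsCoprime P Q) (h₀ : p x₀ = P * Q) :
    ∃ p₁ p₂ : V → ℝ[X], CoeffAnalyticAt p₁ x₀ ∧ CoeffAnalyticAt p₂ x₀ ∧
      (∀ x, (p₁ x).Monic ∧ (p₁ x).natDegree = k) ∧ (∀ x, (p₂ x).Monic ∧ (p₂ x).natDegree = m) ∧
      p₁ x₀ = P ∧ p₂ x₀ = Q ∧ ∀ᶠ x in 𝓝 x₀, p x = p₁ x * p₂ x := by
  set Φ := mulCoeffs (k := k) (m := m) P Q
  have han : AnalyticAt ℝ Φ 0 := analyticAt_mulCoeffs P Q 0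
  -- Both spaces have dimension `k + m`, so injectivity suffices for an isomorphism.
  let e := (LinearMap.linearEquivOfInjective (fderiv ℝ Φ 0).toLinearMap
    (fderiv_mulCoeffs_injective hP hQ hk hm hPQ) (by simp)).toContinuousLinearEquiv
  have he : (e : ((Fin k → ℝ) × (Fin m → ℝ)) →L[ℝ] (Fin (k + m) → ℝ)) = fderiv ℝ Φ 0 := by
    ext <;> rfl
  have hs : HasStrictFDerivAt Φ (e : ((Fin k → ℝ) × (Fin m → ℝ)) →L[ℝ] (Fin (k + m) → ℝ)) 0 :=
    he ▸ han.hasStrictFDerivAt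
  set H := hs.toOpenPartialHomeomorph Φ with hH
  have hHc : ∀ z, H z = Φ z := fun z => rfl
  have h0s : (0 : (Fin k → ℝ) × (Fin m → ℝ)) ∈ H.source := hs.mem_toOpenPartialHomeomorph_source
  have hsymm : AnalyticAt ℝ H.symm (H 0) := H.analyticAt_symm' h0s han he.symm
  let t : V → Fin (k + m) → ℝ := fun x i => (p x).coeff i
  have ht : AnalyticAt ℝ t x₀ := analyticAt_pi_iff.2 fun i => hp i
  have h00 : ∀ j, ofCoeffs (0 : Fin j → ℝ) = 0 := fun j => by simp [ofCoeffs]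
  have ht0 : t x₀ = H 0 := by
    funext i
    simp [t, hHc, Φ, mulCoeffs, h₀, h00]
  set z : V → (Fin k → ℝ) × (Fin m → ℝ) := fun x => H.symm (t x)
  have hz : AnalyticAt ℝ z x₀ := AnalyticAt.fun_comp (ht0 ▸ hsymm) ht
  have hz0 : z x₀ = 0 := by simp only [z, ht0, H.left_inv h0s]
  refine ⟨fun x => P + ofCoeffs (z x).1, fun x => Q + ofCoeffs (z x).2,
    (CoeffAnalyticAt.const P).add (coeffAnalyticAt_ofCoeffs (analyticAt_fst.fun_comp hz)),
    (CoeffAnalyticAt.const Q).add (coeffAnalyticAt_ofCoeffs (analyticAt_snd.fun_comp hz)),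
    fun x => monic_add_ofCoeffs hP hk _, fun x => monic_add_ofCoeffs hQ hm _,
    by simp [hz0, h00], by simp [hz0, h00], ?_⟩
  have htarget : ∀ᶠ x in 𝓝 x₀, t x ∈ H.target :=
    ht.continuousAt.eventually_mem (ht0 ▸ H.open_target.mem_nhds (H.map_source h0s))
  filter_upwards [htarget] with x hx
  have hΦ : Φ (z x) = t x := H.right_inv hx
  obtain ⟨h1, h1'⟩ := monic_add_ofCoeffs hP hk (z x).1
  obtain ⟨h2, h2'⟩ := monic_add_ofCoeffs hQ hm (z x).2
  have h3 := h1.mul h2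
  have h3' := h1.natDegree_mul h2
  rw [h1', h2'] at h3'
  ext i
  rcases lt_trichotomy i (k + m) with hi | hi | hi
  · exact (congrFun hΦ ⟨i, hi⟩).symm
  · have e1 := (hpm x).1.coeff_natDegree
    have e2 := h3.coeff_natDegree
    rw [(hpm x).2, ← hi] at e1
    rw [h3', ← hi] at e2
    rw [e1, e2]
  · rw [coeff_eq_zero_of_natDegree_lt ((hpm x).2.trans_lt hi),
      coeff_eq_zero_of_natDegree_lt (h3'.trans_lt hi)]

end

/-! ### Centering and desingularization of real-rooted families -/

section

open Polynomial

theorem eq_of_eventually_nhdsNE {f g : ℝ → ℝ} {x₀ : ℝ} (hf : ContinuousAt f x₀)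
    (hg : ContinuousAt g x₀) (h : ∀ᶠ x in 𝓝[≠] x₀, f x = g x) : f x₀ = g x₀ :=
  tendsto_nhds_unique_of_eventuallyEq (hf.tendsto.mono_left nhdsWithin_le_nhds)
    (hg.tendsto.mono_left nhdsWithin_le_nhds) h

/-- An analytic function that is `O((x - x₀) ^ N)` is analytically divisible by `(x - x₀) ^ N`. -/
theorem exists_eq_pow_mul_of_abs_le {f : ℝ → ℝ} {x₀ C : ℝ} {N : ℕ} (hf : AnalyticAt ℝ f x₀)
    (h : ∀ᶠ x in 𝓝[≠] x₀, |f x| ≤ C * |x - x₀| ^ N) :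
    ∃ g : ℝ → ℝ, AnalyticAt ℝ g x₀ ∧ ∀ᶠ x in 𝓝 x₀, f x = (x - x₀) ^ N * g x := by
  suffices hN : (N : ℕ∞) ≤ analyticOrderAt f x₀ by
    simpa using (natCast_le_analyticOrderAt hf).1 hN
  by_contra! hlt
  obtain ⟨j, hj⟩ := ENat.ne_top_iff_exists.1 hlt.ne_top
  rw [← hj, Nat.cast_lt] at hlt
  obtain ⟨g, hg, hg0, hfg⟩ := hf.analyticOrderAt_eq_natCast.1 hj.symm
  have hbound : ∀ᶠ x in 𝓝[≠] x₀, |g x| ≤ C * |x - x₀| ^ (N - j) := by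
    filter_upwards [h, hfg.filter_mono nhdsWithin_le_nhds, self_mem_nhdsWithin] with x hx hx' hne
    have hpos : 0 < |x - x₀| ^ j := pow_pos (abs_pos.2 (sub_ne_zero.2 hne)) j
    rw [hx', smul_eq_mul, abs_mul, abs_pow, ← Nat.add_sub_cancel' hlt.le, pow_add,
      mul_left_comm] at hx
    exact le_of_mul_le_mul_left hx hpos
  have hlim : Tendsto (fun x => C * |x - x₀| ^ (N - j)) (𝓝[≠] x₀) (𝓝 0) := by
    have : ContinuousAt (fun x => C * |x - x₀| ^ (N - j)) x₀ := by fun_prop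
    have := this.tendsto.mono_left (nhdsWithin_le_nhds (s := {x₀}ᶜ))
    simpa [(Nat.sub_pos_of_lt hlt).ne'] using this
  have : |g x₀| ≤ 0 := le_of_tendsto_of_tendsto
    (hg.continuousAt.abs.tendsto.mono_left nhdsWithin_le_nhds) hlim hbound
  exact hg0 (abs_nonpos_iff.1 this)

/-- Newton's identity. For a centered polynomial it identifies `-2` times the third highest
coefficient with the sum of the squared roots. -/
theorem sum_sq_eq_sum_map_sq_add_esymm (s : Multiset ℝ) :
    s.sum ^ 2 = (s.map (· ^ 2)).sum + 2 * s.esymm 2 := by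
  induction s using Multiset.induction_on with
  | empty => simp [Multiset.esymm, Multiset.powersetCard_zero_right]
  | cons a s ih =>
    have h : (a ::ₘ s).esymm 2 = s.esymm 2 + a * s.sum := by
      simp only [Multiset.esymm, Multiset.powersetCard_cons, Multiset.powersetCard_one,
        Multiset.map_add, Multiset.sum_add, Multiset.map_map, Function.comp_def,
        Multiset.prod_cons, Multiset.prod_singleton]
      rw [Multiset.sum_map_mul_left, Multiset.map_id']
    rw [h, Multiset.sum_cons, Multiset.map_cons, Multiset.sum_cons]
    linear_combination ih

theorem exists_isRoot_of_splits {P : ℝ[X]} (hs : P.Splits) (h : P.natDegree ≠ 0) :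
    ∃ r, P.IsRoot r :=
  hs.exists_eval_eq_zero fun h0 => h (natDegree_eq_of_degree_eq_some h0)

/-- For a centered real-rooted monic polynomial, the second elementary symmetric function of the
roots controls all roots. -/
theorem sq_root_le_of_splits {n : ℕ} {P : ℝ[X]} (hP : P.Monic) (hn : P.natDegree = n + 2)
    (hs : P.Splits) (hc : P.coeff (n + 1) = 0) {r : ℝ} (hr : P.IsRoot r) :
    r ^ 2 ≤ -2 * P.coeff n := by
  have h1 := coeff_eq_esymm_roots_of_splits hs (k := n + 1) (by omega)
  have h2 := coeff_eq_esymm_roots_of_splits hs (k := n) (by omega)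
  rw [hP.leadingCoeff, hn, show n + 2 - (n + 1) = 1 by omega, hc] at h1
  rw [hP.leadingCoeff, hn, show n + 2 - n = 2 by omega] at h2
  have hsum : P.roots.sum = 0 := by
    simpa [Multiset.esymm, Multiset.powersetCard_one] using h1
  have key := sum_sq_eq_sum_map_sq_add_esymm P.roots
  rw [hsum] at key
  have hle : r ^ 2 ≤ (P.roots.map (· ^ 2)).sum :=
    Multiset.single_le_sum (fun x hx => by
      obtain ⟨y, -, rfl⟩ := Multiset.mem_map.1 hx
      positivity) _ (Multiset.mem_map_of_mem _ ((mem_roots hP.ne_zero).2 hr))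
  rw [h2]
  linarith

/-- To the right of `x₀`, the largest root of the family is an analytic function. -/
def HasAnalyticTopRoot (p : ℝ → ℝ[X]) (x₀ : ℝ) : Prop :=
  ∃ g : ℝ → ℝ, AnalyticAt ℝ g x₀ ∧ ∀ᶠ x in 𝓝[>] x₀, IsGreatest {r | (p x).IsRoot r} (g x)

theorem HasAnalyticTopRoot.of_taylor {p : ℝ → ℝ[X]} {x₀ : ℝ} {s : ℝ → ℝ} (hs : AnalyticAt ℝ s x₀)
    (h : HasAnalyticTopRoot (fun x => taylor (s x) (p x)) x₀) : HasAnalyticTopRoot p x₀ := by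
  obtain ⟨g, hg, hgp⟩ := h
  refine ⟨fun x => g x + s x, hg.fun_add hs, hgp.mono fun x hx => ⟨?_, fun r hr => ?_⟩⟩
  · have := hx.1
    simpa [IsRoot, taylor_eval] using this
  · have : r - s x ≤ g x := hx.2 (by simpa [IsRoot, taylor_eval] using hr)
    linarith

/-- Right of `x₀` the factor `(x - x₀) ^ m` is positive and preserves the order of the roots. This
is why the largest root is treated one side at a time. -/
theorem HasAnalyticTopRoot.of_scaleRoots {p q : ℝ → ℝ[X]} {x₀ : ℝ} {m : ℕ}
    (h : HasAnalyticTopRoot q x₀)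
    (hpq : ∀ᶠ x in 𝓝[≠] x₀, p x = scaleRoots (q x) ((x - x₀) ^ m)) : HasAnalyticTopRoot p x₀ := by
  obtain ⟨g, hg, hgp⟩ := h
  refine ⟨fun x => (x - x₀) ^ m * g x,
    ((analyticAt_id.fun_sub analyticAt_const).fun_pow m).fun_mul hg, ?_⟩
  filter_upwards [hgp, hpq.filter_mono (nhdsGT_le_nhdsNE x₀), self_mem_nhdsWithin] with x hx hpx hlt
  have hpos : 0 < (x - x₀) ^ m := pow_pos (sub_pos.2 hlt) m
  refine ⟨?_, fun r hr => ?_⟩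
  · have : (q x).eval (g x) = 0 := hx.1
    simp [hpx, IsRoot, scaleRoots_eval_mul, this]
  · have h1 : (p x).eval ((x - x₀) ^ m * (r / (x - x₀) ^ m)) = 0 := by
      rw [mul_div_cancel₀ _ hpos.ne']
      exact hr
    rw [hpx, scaleRoots_eval_mul] at h1
    have h2 : r / (x - x₀) ^ m ≤ g x :=
      hx.2 ((mul_eq_zero.1 h1).resolve_left (pow_pos hpos _).ne')
    rw [div_le_iff₀ hpos] at h2
    linarith

theorem coeffAnalyticAt_taylor {n : ℕ} {p : ℝ → ℝ[X]} {x₀ : ℝ} (hp : CoeffAnalyticAt p x₀)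
    (hn : ∀ x, (p x).natDegree ≤ n) {s : ℝ → ℝ} (hs : AnalyticAt ℝ s x₀) :
    CoeffAnalyticAt (fun x => taylor (s x) (p x)) x₀ := fun i => by
  simp only [taylor_coeff]
  refine CoeffAnalyticAt.eval (p := fun x => hasseDeriv i (p x)) (n := n) (fun j => ?_)
    (fun x => (natDegree_hasseDeriv_le _ _).trans ((Nat.sub_le _ _).trans (hn x))) hs
  simp only [hasseDeriv_coeff]
  exact analyticAt_const.fun_mul (hp _)

/-- Shifting by the mean of the roots, `-P.coeff n / (n + 1)`, therefore kills the second highest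
coefficient. -/
theorem coeff_taylor_of_natDegree_eq_succ {n : ℕ} {P : ℝ[X]} (hP : P.Monic)
    (hn : P.natDegree = n + 1) (s : ℝ) :
    (taylor s P).coeff n = P.coeff n + (n + 1) * s := by
  have h := hP.coeff_natDegree
  rw [hn] at h
  rw [taylor_coeff, eval_eq_sum_range' (n := 2)
    ((natDegree_hasseDeriv_le P n).trans_lt (by omega))]
  simp [Finset.sum_range_succ, hasseDeriv_coeff, add_comm 1 n, h]

/-- The right side gives `0 ≤ c x₀`; for odd `N` the left side would give the opposite sign. -/
theorem even_of_eventually_pow_mul_nonneg {c : ℝ → ℝ} {x₀ : ℝ} {N : ℕ} (hc : ContinuousAt c x₀)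
    (hc0 : c x₀ ≠ 0) (h : ∀ᶠ x in 𝓝[≠] x₀, 0 ≤ (x - x₀) ^ N * c x) : Even N ∧ 0 < c x₀ := by
  have hright : 0 ≤ c x₀ := by
    refine ge_of_tendsto (hc.tendsto.mono_left (nhdsWithin_le_nhds (s := Set.Ioi x₀))) ?_
    filter_upwards [h.filter_mono (nhdsGT_le_nhdsNE x₀), self_mem_nhdsWithin] with x hx hlt
    exact nonneg_of_mul_nonneg_right hx (pow_pos (sub_pos.2 hlt) N)
  refine ⟨?_, lt_of_le_of_ne hright hc0.symm⟩
  by_contra hN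
  rw [Nat.not_even_iff_odd] at hN
  refine hc0 (le_antisymm ?_ hright)
  refine le_of_tendsto (hc.tendsto.mono_left (nhdsWithin_le_nhds (s := Set.Iio x₀))) ?_
  have hle : 𝓝[<] x₀ ≤ 𝓝[≠] x₀ := nhdsWithin_mono _ fun _ hx => ne_of_lt hx
  filter_upwards [h.filter_mono hle, self_mem_nhdsWithin] with x hx hlt
  have hneg : (x - x₀) ^ N < 0 := hN.pow_neg (sub_neg.2 hlt)
  by_contra! hpos
  exact absurd hx (not_le.2 (mul_neg_of_neg_of_pos hneg hpos))

/-- Desingularization: a centered real-rooted analytic family is a rescaling of one whose member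
at `x₀` has at least two distinct roots, unless all roots vanish identically. -/
theorem exists_scaleRoots_family {n : ℕ} {p : ℝ → ℝ[X]} {x₀ : ℝ} (hp : CoeffAnalyticAt p x₀)
    (hpm : ∀ x, (p x).Monic ∧ (p x).natDegree = n + 2) (hps : ∀ᶠ x in 𝓝[≠] x₀, (p x).Splits)
    (hpc : ∀ᶠ x in 𝓝[≠] x₀, (p x).coeff (n + 1) = 0)
    (hne : ¬ ∀ᶠ x in 𝓝 x₀, -2 * (p x).coeff n = 0) :
    ∃ (m : ℕ) (q : ℝ → ℝ[X]), CoeffAnalyticAt q x₀ ∧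
      (∀ x, (q x).Monic ∧ (q x).natDegree = n + 2) ∧ (∀ᶠ x in 𝓝[≠] x₀, (q x).Splits) ∧
      (∀ᶠ x in 𝓝[≠] x₀, p x = scaleRoots (q x) ((x - x₀) ^ m)) ∧
      ∀ μ, q x₀ ≠ (X - C μ) ^ (n + 2) := by
  -- Near `x₀`, off `x₀`, this is the sum of the squared roots, so its order of vanishing is even,
  -- say `2 * m`, and all roots are `O(|x - x₀| ^ m)`.
  have hD : AnalyticAt ℝ (fun x => -2 * (p x).coeff n) x₀ := analyticAt_const.fun_mul (hp n)
  obtain ⟨N, c, hc, hc0, hDc⟩ := hD.exists_eventuallyEq_pow_smul_nonzero_iff.2 hne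
  have hDc' : ∀ᶠ x in 𝓝[≠] x₀, -2 * (p x).coeff n = (x - x₀) ^ N * c x :=
    hDc.filter_mono nhdsWithin_le_nhds
  have hroot : ∀ᶠ x in 𝓝[≠] x₀, ∀ r, (p x).IsRoot r → r ^ 2 ≤ (x - x₀) ^ N * c x := by
    filter_upwards [hDc', hps, hpc] with x h1 h2 h3 r hr
    rw [← h1]
    exact sq_root_le_of_splits (hpm x).1 (hpm x).2 h2 h3 hr
  have hpos : ∀ᶠ x in 𝓝[≠] x₀, 0 ≤ (x - x₀) ^ N * c x := by
    filter_upwards [hroot, hps] with x h1 h2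
    obtain ⟨r, hr⟩ := exists_isRoot_of_splits h2 (by rw [(hpm x).2]; omega)
    exact (sq_nonneg r).trans (h1 r hr)
  obtain ⟨⟨m, hm⟩, hcpos⟩ := even_of_eventually_pow_mul_nonneg hc.continuousAt hc0 hpos
  set B := Real.sqrt (c x₀ + 1)
  have hroot' : ∀ᶠ x in 𝓝[≠] x₀, ∀ r, (p x).IsRoot r → ‖r‖ ≤ B * |x - x₀| ^ m := by
    filter_upwards [hroot, (hc.continuousAt.eventually_lt_const
      (lt_add_one (c x₀))).filter_mono nhdsWithin_le_nhds] with x h1 h2 r hr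
    refine abs_le_of_sq_le_sq ((h1 r hr).trans ?_) (by positivity)
    rw [mul_pow, Real.sq_sqrt (by linarith), hm, ← pow_mul, mul_comm m 2, ← two_mul,
      pow_mul |x - x₀|, sq_abs, ← pow_mul, mul_comm]
    have : 0 ≤ (x - x₀) ^ (2 * m) := by rw [pow_mul]; positivity
    gcongr
  -- Up to sign, coefficient `i` is the elementary symmetric function of degree `n + 2 - i` in the
  -- roots, which fixes its order of smallness.
  have hcoeff : ∀ i : Fin (n + 2), ∃ g : ℝ → ℝ, AnalyticAt ℝ g x₀ ∧
      ∀ᶠ x in 𝓝 x₀, (p x).coeff i = (x - x₀) ^ (m * (n + 2 - i)) * g x := by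
    intro i
    refine exists_eq_pow_mul_of_abs_le (C := B ^ (n + 2 - (i : ℕ)) * (n + 2).choose i) (hp i) ?_
    filter_upwards [hroot', hps] with x h1 h2
    have := coeff_le_of_roots_le (f := RingHom.id ℝ) (i : ℕ) (hpm x).1 (by simpa using h2)
      (B := B * |x - x₀| ^ m)
      (fun z hz => h1 z (by simpa using isRoot_of_mem_roots hz))
    rw [Polynomial.map_id, (hpm x).2, mul_pow, ← pow_mul, Real.norm_eq_abs] at this
    linarith
  choose g hg hpg using hcoeff
  set q : ℝ → ℝ[X] := fun x => X ^ (n + 2) + ofCoeffs (fun i => g i x) with hq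
  have hqm : ∀ x, (q x).Monic ∧ (q x).natDegree = n + 2 := fun x =>
    monic_add_ofCoeffs (monic_X_pow _) (natDegree_X_pow _) _
  have hqc : ∀ x (i : Fin (n + 2)), (q x).coeff i = g i x := fun x i => by
    simp [hq, coeff_ofCoeffs, coeff_X_pow, i.2.ne]
  have hqa : CoeffAnalyticAt q x₀ := (CoeffAnalyticAt.const _).add
    (coeffAnalyticAt_ofCoeffs (analyticAt_pi_iff.2 hg))
  have hscale : ∀ᶠ x in 𝓝 x₀, p x = scaleRoots (q x) ((x - x₀) ^ m) := by
    filter_upwards [eventually_all.2 hpg] with x hx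
    ext i
    rw [coeff_scaleRoots, (hqm x).2]
    rcases lt_trichotomy i (n + 2) with hi | hi | hi
    · have h1 := hx ⟨i, hi⟩
      have h2 := hqc x ⟨i, hi⟩
      simp only at h1 h2
      rw [h1, h2, ← pow_mul, mul_comm]
    · have e1 := (hpm x).1.coeff_natDegree
      have e2 := (hqm x).1.coeff_natDegree
      rw [(hpm x).2] at e1
      rw [(hqm x).2] at e2
      rw [hi, e1, e2]
      simp
    · rw [coeff_eq_zero_of_natDegree_lt ((hpm x).2.trans_lt hi),
        coeff_eq_zero_of_natDegree_lt ((hqm x).2.trans_lt hi), zero_mul]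
  refine ⟨m, q, hqa, hqm, ?_, hscale.filter_mono nhdsWithin_le_nhds, fun μ hμ => ?_⟩
  · filter_upwards [hscale.filter_mono nhdsWithin_le_nhds, hps, self_mem_nhdsWithin]
      with x hx hxs hne
    have h0 : (x - x₀) ^ m ≠ 0 := pow_ne_zero _ (sub_ne_zero.2 hne)
    have := hxs.scaleRoots ((x - x₀) ^ m)⁻¹
    rwa [hx, ← scaleRoots_mul, mul_inv_cancel₀ h0, scaleRoots_one] at this
  -- By continuity `q x₀` is still centered, which forces `μ = 0`; but then its coefficient `n`
  -- vanishes, against `c x₀ ≠ 0`.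
  · have h1 : (q x₀).coeff (n + 1) = 0 := by
      refine eq_of_eventually_nhdsNE (f := fun x => (q x).coeff (n + 1)) (g := fun _ => 0)
        (hqa _).continuousAt continuousAt_const ?_
      filter_upwards [hscale.filter_mono nhdsWithin_le_nhds, hpc, self_mem_nhdsWithin]
        with x hx hxc hne
      rw [hx, coeff_scaleRoots] at hxc
      exact (mul_eq_zero.1 hxc).resolve_right
        (pow_ne_zero _ (pow_ne_zero _ (sub_ne_zero.2 hne)))
    have h2 : -2 * (q x₀).coeff n = c x₀ := by
      refine eq_of_eventually_nhdsNE (f := fun x => -2 * (q x).coeff n)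
        (continuousAt_const.mul (hqa _).continuousAt) hc.continuousAt ?_
      filter_upwards [hscale.filter_mono nhdsWithin_le_nhds, hDc', self_mem_nhdsWithin]
        with x hx hxc hne
      rw [hx, coeff_scaleRoots, (hqm x).2, Nat.add_sub_cancel_left, ← pow_mul, hm, mul_two] at hxc
      exact mul_left_cancel₀ (pow_ne_zero (m + m) (sub_ne_zero.2 hne))
        (by linear_combination hxc)
    rw [hμ, sub_eq_add_neg, ← C_neg, coeff_X_add_C_pow, show n + 2 - (n + 1) = 1 by omega,
      pow_one] at h1
    have hμ0 : μ = 0 := by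
      have : ((n + 2).choose (n + 1) : ℝ) ≠ 0 := by
        exact_mod_cast (Nat.choose_pos (by omega)).ne'
      simpa using (mul_eq_zero.1 h1).resolve_right this
    rw [hμ, sub_eq_add_neg, ← C_neg, coeff_X_add_C_pow, hμ0, Nat.add_sub_cancel_left] at h2
    apply hc0
    rw [← h2]
    simp

end

/-! ### Rellich's theorem for the largest root -/

section

open Polynomial

theorem HasAnalyticTopRoot.of_isRoot_eq_zero {n : ℕ} {p : ℝ → ℝ[X]} {x₀ : ℝ}
    (hpm : ∀ x, (p x).Monic ∧ (p x).natDegree = n + 1) (hps : ∀ᶠ x in 𝓝[≠] x₀, (p x).Splits)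
    (h : ∀ᶠ x in 𝓝[≠] x₀, ∀ r, (p x).IsRoot r → r = 0) : HasAnalyticTopRoot p x₀ := by
  refine ⟨fun _ => 0, analyticAt_const, ?_⟩
  filter_upwards [h.filter_mono (nhdsGT_le_nhdsNE x₀), hps.filter_mono (nhdsGT_le_nhdsNE x₀)]
    with x h1 h2
  obtain ⟨r, hr⟩ := exists_isRoot_of_splits h2 (by rw [(hpm x).2]; omega)
  exact ⟨h1 r hr ▸ hr, fun r' hr' => (h1 r' hr').le⟩

/-- The limit of a real-rooted family has a real root. -/
theorem exists_isRoot_of_eventually_splits {n : ℕ} {p : ℝ → ℝ[X]} {x₀ : ℝ}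
    (hp : CoeffAnalyticAt p x₀) (hpm : ∀ x, (p x).Monic ∧ (p x).natDegree = n + 1)
    (hps : ∀ᶠ x in 𝓝[≠] x₀, (p x).Splits) : ∃ r, (p x₀).IsRoot r := by
  by_contra! hno
  obtain ⟨M, hM⟩ := hp.exists_root_bound hpm
  have h1 := hp.eventually_eval_ne_zero (fun x => (hpm x).2.le) (isCompact_closedBall (0 : ℝ) M)
    fun r _ => hno r
  obtain ⟨x, hx1, hx2, hx3⟩ := ((hM.filter_mono nhdsWithin_le_nhds).and
    ((h1.filter_mono nhdsWithin_le_nhds).and hps)).exists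
  obtain ⟨r, hr⟩ := exists_isRoot_of_splits hx3 (by rw [(hpm x).2]; omega)
  exact hx2 r (mem_closedBall_zero_iff.2 (hx1 r hr)) hr

/-- Splitting off the largest root of the member at `x₀`. -/
theorem HasAnalyticTopRoot.of_ne_pow {n : ℕ} {p : ℝ → ℝ[X]} {x₀ : ℝ}
    (hp : CoeffAnalyticAt p x₀) (hpm : ∀ x, (p x).Monic ∧ (p x).natDegree = n + 1)
    (hps : ∀ᶠ x in 𝓝[≠] x₀, (p x).Splits) (hne : ∀ μ, p x₀ ≠ (X - C μ) ^ (n + 1))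
    (ih : ∀ k < n, ∀ q : ℝ → ℝ[X], CoeffAnalyticAt q x₀ →
      (∀ x, (q x).Monic ∧ (q x).natDegree = k + 1) → (∀ᶠ x in 𝓝[≠] x₀, (q x).Splits) →
      HasAnalyticTopRoot q x₀) : HasAnalyticTopRoot p x₀ := by
  have hp0 : p x₀ ≠ 0 := (hpm x₀).1.ne_zero
  obtain ⟨r₀, hr₀⟩ := exists_isRoot_of_eventually_splits hp hpm hps
  obtain ⟨μ, hμ, hmax⟩ := (p x₀).roots.toFinset.exists_max_image id
    ⟨r₀, by simpa [hp0] using hr₀⟩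
  simp only [Multiset.mem_toFinset, mem_roots hp0, id] at hμ hmax
  obtain ⟨Q, hpQ, hQ⟩ := exists_eq_pow_rootMultiplicity_mul_and_not_dvd (p x₀) hp0 μ
  set k := (p x₀).rootMultiplicity μ
  have hk : 0 < k := (rootMultiplicity_pos hp0).2 hμ
  have hPm : ((X - C μ) ^ k).Monic := (monic_X_sub_C μ).pow k
  have hPd : ((X - C μ) ^ k).natDegree = k := by
    rw [(monic_X_sub_C μ).natDegree_pow, natDegree_X_sub_C, mul_one]
  have hQm : Q.Monic := hPm.of_mul_monic_left (hpQ ▸ (hpm x₀).1)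
  have hdeg : k + Q.natDegree = n + 1 := by
    have := hPm.natDegree_mul hQm
    rw [← hpQ, (hpm x₀).2, hPd] at this
    exact this.symm
  -- Not being a pure power makes the factor through `μ`, the largest real root of `p x₀`, of
  -- smaller degree, so that `ih` applies (with `k - 1`, one less than the degree).
  have hkn : k < n + 1 := by
    by_contra! hle
    have hQ1 : Q = 1 := hQm.natDegree_eq_zero.1 (by omega)
    refine hne μ ?_
    rw [hpQ, hQ1, mul_one, show k = n + 1 by omega]
  have hcop : IsCoprime ((X - C μ) ^ k) Q :=
    ((irreducible_X_sub_C μ).coprime_iff_not_dvd.2 hQ).pow_left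
  obtain ⟨p₁, p₂, hp₁, hp₂, hm₁, hm₂, h₁, h₂, hfac⟩ := exists_factor_family hp
    (fun x => ⟨(hpm x).1, (hpm x).2.trans hdeg.symm⟩) hPm hQm hPd rfl hcop hpQ
  have hs₁ : ∀ᶠ x in 𝓝[≠] x₀, (p₁ x).Splits := by
    filter_upwards [hps, hfac.filter_mono nhdsWithin_le_nhds] with x hx hxf
    exact hx.of_dvd (hpm x).1.ne_zero ⟨_, hxf⟩
  obtain ⟨g, hg, hgp⟩ := ih (k - 1) (by omega) p₁ hp₁
    (fun x => ⟨(hm₁ x).1, (hm₁ x).2.trans (by omega)⟩) hs₁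
  have hQμ : ∀ r, μ ≤ r → Q.eval r ≠ 0 := by
    intro r hr h0
    rcases hr.eq_or_lt with rfl | hlt
    · exact hQ (dvd_iff_isRoot.2 h0)
    · exact absurd (hmax r (by simp [hpQ, IsRoot, h0])) (not_le.2 hlt)
  -- `Q` has no root from `μ - δ / 2` upwards. By compactness this level separates, for `x` near
  -- `x₀`, the real roots of `p₁ x` (above) from those of `p₂ x` (below).
  obtain ⟨δ, hδ, hδQ⟩ := Metric.eventually_nhds_iff_ball.1
    (Q.continuous.continuousAt.eventually_ne (hQμ μ le_rfl))
  have hQδ : ∀ r, μ - δ / 2 ≤ r → Q.eval r ≠ 0 := by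
    intro r hr
    rcases le_total μ r with h | h
    · exact hQμ r h
    · exact hδQ r (by rw [Metric.mem_ball, Real.dist_eq, abs_lt]; constructor <;> linarith)
  obtain ⟨M₁, hM₁⟩ := hp₁.exists_root_bound hm₁
  obtain ⟨M₂, hM₂⟩ := hp₂.exists_root_bound hm₂
  have hK₁ := hp₁.eventually_eval_ne_zero (fun x => (hm₁ x).2.le)
    (isCompact_Icc (a := -M₁) (b := μ - δ / 2)) fun r hr => by
      rw [h₁, eval_pow]
      exact pow_ne_zero _ (by simpa [sub_eq_zero] using (by linarith [hr.2] : r < μ).ne)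
  have hK₂ := hp₂.eventually_eval_ne_zero (fun x => (hm₂ x).2.le)
    (isCompact_Icc (a := μ - δ / 2) (b := M₂)) fun r hr => by
      rw [h₂]
      exact hQδ r hr.1
  refine ⟨g, hg, ?_⟩
  have hle : 𝓝[>] x₀ ≤ 𝓝 x₀ := nhdsWithin_le_nhds
  filter_upwards [hgp, hfac.filter_mono hle, hM₁.filter_mono hle, hM₂.filter_mono hle,
    hK₁.filter_mono hle, hK₂.filter_mono hle] with x hgx hxf hx₁ hx₂ hy₁ hy₂
  have hgx' : (p₁ x).eval (g x) = 0 := hgx.1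
  refine ⟨by simp [hxf, IsRoot, hgx'], fun r hr => ?_⟩
  have hr' : (p₁ x * p₂ x).eval r = 0 := hxf ▸ hr
  rw [eval_mul, mul_eq_zero] at hr'
  rcases hr' with h | h
  · exact hgx.2 h
  · have e1 : r < μ - δ / 2 := by
      by_contra! hle
      exact hy₂ r ⟨hle, (abs_le.1 (hx₂ r h)).2⟩ h
    have e2 : μ - δ / 2 < g x := by
      by_contra! hle
      exact hy₁ (g x) ⟨(abs_le.1 (hx₁ _ hgx')).1, hle⟩ hgx'
    exact (e1.trans e2).le

/-- **Rellich's theorem** for the largest root: an analytic one-parameter family of real-rooted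
monic polynomials has a one-sided analytic largest root. -/
theorem hasAnalyticTopRoot {x₀ : ℝ} (n : ℕ) : ∀ p : ℝ → ℝ[X], CoeffAnalyticAt p x₀ →
    (∀ x, (p x).Monic ∧ (p x).natDegree = n + 1) → (∀ᶠ x in 𝓝[≠] x₀, (p x).Splits) →
    HasAnalyticTopRoot p x₀ := by
  induction n using Nat.strong_induction_on with
  | _ n ih =>
  intro p hp hpm hps
  have hs : AnalyticAt ℝ (fun x => -(p x).coeff n / (n + 1)) x₀ :=
    (hp n).fun_neg.fun_div analyticAt_const (by positivity)
  refine HasAnalyticTopRoot.of_taylor hs ?_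
  set q : ℝ → ℝ[X] := fun x => taylor (-(p x).coeff n / (n + 1)) (p x) with hq
  have hqa : CoeffAnalyticAt q x₀ := coeffAnalyticAt_taylor hp (fun x => (hpm x).2.le) hs
  have hqm : ∀ x, (q x).Monic ∧ (q x).natDegree = n + 1 := fun x =>
    ⟨(leadingCoeff_taylor _ _).trans (hpm x).1, by simp [hq, (hpm x).2]⟩
  have hqs : ∀ᶠ x in 𝓝[≠] x₀, (q x).Splits := hps.mono fun x hx => by
    simpa only [hq, taylor_apply] using hx.comp_X_add_C _
  have hqc : ∀ x, (q x).coeff n = 0 := fun x => by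
    simp only [hq]
    rw [coeff_taylor_of_natDegree_eq_succ (hpm x).1 (hpm x).2]
    field_simp
    ring
  clear_value q
  rcases n with _ | n
  · refine HasAnalyticTopRoot.of_isRoot_eq_zero hqm hqs (Eventually.of_forall fun x r hr => ?_)
    have h1 := (hqm x).1.coeff_natDegree
    rw [(hqm x).2] at h1
    have h2 : (q x).eval r = 0 := hr
    rw [eval_eq_sum_range, (hqm x).2] at h2
    simpa [Finset.sum_range_succ, hqc x, h1] using h2
  -- Either all centered roots vanish near `x₀`, or rescaling separates roots at `x₀` and the degree
  -- drops.
  · by_cases hD : ∀ᶠ x in 𝓝 x₀, -2 * (q x).coeff n = 0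
    · refine HasAnalyticTopRoot.of_isRoot_eq_zero hqm hqs ?_
      filter_upwards [hD.filter_mono nhdsWithin_le_nhds, hqs] with x h1 h2 r hr
      have := sq_root_le_of_splits (hqm x).1 (hqm x).2 h2 (hqc x) hr
      rw [h1] at this
      exact pow_eq_zero_iff two_ne_zero |>.1 (le_antisymm this (sq_nonneg r))
    · obtain ⟨m, q', h1, h2, h3, h4, h5⟩ := exists_scaleRoots_family hqa hqm hqs
        (Eventually.of_forall hqc) hD
      exact (HasAnalyticTopRoot.of_ne_pow h1 h2 h3 h5 fun k hk => ih k hk).of_scaleRoots h4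

end

/-! ### The largest eigenvalue of an analytic Hermitian family -/

section

open Polynomial Matrix

theorem coeffAnalyticAt_charpoly {V : Type*} [NormedAddCommGroup V] [NormedSpace ℝ V] {n : ℕ}
    {M : V → Matrix (Fin n) (Fin n) ℂ} {x₀ : V}
    (hM : ∀ i j, AnalyticAt ℝ (fun x => M x i j) x₀) :
    CoeffAnalyticAt (fun x => (M x).charpoly) x₀ := by
  have : (fun x => (M x).charpoly) = fun x => ∑ σ : Equiv.Perm (Fin n),
      ((Equiv.Perm.sign σ : ℤ) : ℂ[X]) *
        ∏ i, (Matrix.diagonal (fun _ : Fin n => (X : ℂ[X])) (σ i) i + C (-M x (σ i) i)) := by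
    funext x
    simp only [Matrix.charpoly, Matrix.det_apply', charmatrix_apply, C_neg, sub_eq_add_neg]
  rw [this]
  exact CoeffAnalyticAt.sum fun σ _ => (CoeffAnalyticAt.const _).mul
    (CoeffAnalyticAt.prod fun i _ => (CoeffAnalyticAt.const _).add
      (CoeffAnalyticAt.C (hM _ _).fun_neg))

variable {n κ : ℕ}

theorem isGreatest_lamMax [NeZero n] {M : Matrix (Fin n) (Fin n) ℂ} (hM : M.IsHermitian) :
    IsGreatest (Set.range hM.eigenvalues) (lamMax M) := by
  rw [lamMax, hM.spectrum_real_eq_range_eigenvalues]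
  exact (Set.finite_range _).isCompact.isGreatest_sSup (Set.range_nonempty _)

/-- The characteristic polynomial of a Hermitian matrix, as a real polynomial. -/
noncomputable def realCharpoly {M : Matrix (Fin n) (Fin n) ℂ} (hM : M.IsHermitian) : ℝ[X] :=
  ∏ i, (X - C (hM.eigenvalues i))

theorem realCharpoly_monic {M : Matrix (Fin n) (Fin n) ℂ} (hM : M.IsHermitian) :
    (realCharpoly hM).Monic := monic_prod_X_sub_C _ _

theorem realCharpoly_natDegree {M : Matrix (Fin n) (Fin n) ℂ} (hM : M.IsHermitian) :
    (realCharpoly hM).natDegree = n := by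
  simp [realCharpoly]

theorem realCharpoly_splits {M : Matrix (Fin n) (Fin n) ℂ} (hM : M.IsHermitian) :
    (realCharpoly hM).Splits := Splits.prod fun _ _ => Splits.X_sub_C _

theorem isRoot_realCharpoly {M : Matrix (Fin n) (Fin n) ℂ} (hM : M.IsHermitian) :
    {r | (realCharpoly hM).IsRoot r} = Set.range hM.eigenvalues := by
  ext r
  simp [realCharpoly, IsRoot, eval_prod, Finset.prod_eq_zero_iff, sub_eq_zero, @eq_comm _ r]

/-- Transfers analyticity from the complex characteristic polynomial to a family that splits over
`ℝ`. -/
theorem coeff_realCharpoly {M : Matrix (Fin n) (Fin n) ℂ} (hM : M.IsHermitian) (i : ℕ) :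
    (realCharpoly hM).coeff i = (M.charpoly.coeff i).re := by
  have : M.charpoly = (realCharpoly hM).map (algebraMap ℝ ℂ) := by
    rw [hM.charpoly_eq, realCharpoly, Polynomial.map_prod]
    simp
  rw [this, coeff_map]
  simp

theorem isHermitian_family {f : Fin κ → ℝ → ℝ} {A : Fin κ → Matrix (Fin n) (Fin n) ℂ}
    (hA : ∀ j, (A j).IsHermitian) (x : ℝ) : (family f A x).IsHermitian := by
  rw [Matrix.IsHermitian, family, conjTranspose_sum]
  refine Finset.sum_congr rfl fun j _ => ?_
  rw [conjTranspose_smul, (hA j).eq, star_trivial]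

open scoped ComplexOrder in
/-- The Rayleigh quotient is bounded by the largest eigenvalue. -/
theorem re_dotProduct_le_lamMax [NeZero n] {M : Matrix (Fin n) (Fin n) ℂ} (hM : M.IsHermitian)
    (v : Fin n → ℂ) : (star v ⬝ᵥ (M *ᵥ v)).re ≤ lamMax M * (star v ⬝ᵥ v).re := by
  have hN : (algebraMap ℝ (Matrix (Fin n) (Fin n) ℂ) (lamMax M) - M).IsHermitian := by
    refine IsHermitian.sub ?_ hM
    rw [Matrix.IsHermitian, Algebra.algebraMap_eq_smul_one, conjTranspose_smul, conjTranspose_one,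
      star_trivial]
  have hpos : (algebraMap ℝ (Matrix (Fin n) (Fin n) ℂ) (lamMax M) - M).PosSemidef := by
    refine hN.posSemidef_iff_eigenvalues_nonneg.2 fun i => ?_
    have hi : hN.eigenvalues i ∈
        spectrum ℝ (algebraMap ℝ (Matrix (Fin n) (Fin n) ℂ) (lamMax M) - M) := by
      rw [hN.spectrum_real_eq_range_eigenvalues]
      exact Set.mem_range_self i
    rw [← spectrum.singleton_sub_eq, hM.spectrum_real_eq_range_eigenvalues] at hi
    obtain ⟨a, rfl, b, hb, hab⟩ := hi
    rw [← hab]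
    exact sub_nonneg.2 ((isGreatest_lamMax hM).2 hb)
  have := (Complex.le_def.1 (hpos.dotProduct_mulVec_nonneg v)).1
  rw [sub_mulVec, dotProduct_sub, Algebra.algebraMap_eq_smul_one, smul_mulVec, one_mulVec,
    dotProduct_smul, Complex.sub_re, Complex.smul_re, smul_eq_mul, Complex.zero_re] at this
  linarith

theorem exists_dotProduct_eq_lamMax [NeZero n] {M : Matrix (Fin n) (Fin n) ℂ}
    (hM : M.IsHermitian) : ∃ v : Fin n → ℂ, (star v ⬝ᵥ v).re = 1 ∧
      (star v ⬝ᵥ (M *ᵥ v)).re = lamMax M := by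
  obtain ⟨i, hi⟩ := (isGreatest_lamMax hM).1
  refine ⟨⇑(hM.eigenvectorBasis i), ?_, by rw [← hi]; exact (hM.eigenvalues_eq i).symm⟩
  rw [dotProduct_comm, ← EuclideanSpace.inner_eq_star_dotProduct, inner_self_eq_norm_sq_to_K,
    hM.eigenvectorBasis.orthonormal.1 i]
  simp

theorem family_dotProduct (f : Fin κ → ℝ → ℝ) (A : Fin κ → Matrix (Fin n) (Fin n) ℂ) (x : ℝ)
    (v : Fin n → ℂ) : (star v ⬝ᵥ (family f A x *ᵥ v)).re =
      ∑ j, f j x * (star v ⬝ᵥ (A j *ᵥ v)).re := by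
  rw [family, Matrix.sum_mulVec, dotProduct_sum, Complex.re_sum]
  refine Finset.sum_congr rfl fun j _ => ?_
  rw [smul_mulVec, dotProduct_smul, Complex.smul_re, smul_eq_mul]

/-- The largest eigenvalue has a differentiable minorant touching it at any given point. -/
theorem exists_minorant [NeZero n] {f : Fin κ → ℝ → ℝ} {A : Fin κ → Matrix (Fin n) (Fin n) ℂ}
    (hA : ∀ j, (A j).IsHermitian) {x₀ : ℝ} (hf : ∀ j, DifferentiableAt ℝ (f j) x₀) :
    ∃ φ : ℝ → ℝ, DifferentiableAt ℝ φ x₀ ∧ φ x₀ = objective f A x₀ ∧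
      ∀ x, φ x ≤ objective f A x := by
  -- The minorant is the Rayleigh quotient of the unit top eigenvector `v` at `x₀`, kept fixed as
  -- `x` varies.
  obtain ⟨v, hv1, hv⟩ := exists_dotProduct_eq_lamMax (isHermitian_family (f := f) hA x₀)
  refine ⟨fun x => ∑ j, f j x * (star v ⬝ᵥ (A j *ᵥ v)).re,
    DifferentiableAt.fun_sum fun j _ => (hf j).mul_const _, ?_, fun x => ?_⟩
  · simp only
    rw [← family_dotProduct, hv, objective]
  · simp only
    rw [← family_dotProduct, objective]
    simpa [hv1] using re_dotProduct_le_lamMax (isHermitian_family (f := f) hA x) v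

theorem analyticAt_family {f : Fin κ → ℝ → ℝ} {A : Fin κ → Matrix (Fin n) (Fin n) ℂ} {x₀ : ℝ}
    (hf : ∀ j, AnalyticAt ℝ (f j) x₀) (i k : Fin n) :
    AnalyticAt ℝ (fun x => family f A x i k) x₀ := by
  simp only [family, Matrix.sum_apply, Matrix.smul_apply]
  exact Finset.analyticAt_fun_sum _ fun j _ => (hf j).fun_smul analyticAt_const

/-- The largest eigenvalue of an analytic Hermitian family is one-sided analytic. -/
theorem exists_analytic_right [NeZero n] {f : Fin κ → ℝ → ℝ}
    {A : Fin κ → Matrix (Fin n) (Fin n) ℂ} (hA : ∀ j, (A j).IsHermitian) {x₀ : ℝ}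
    (hf : ∀ j, AnalyticAt ℝ (f j) x₀) :
    ∃ g : ℝ → ℝ, AnalyticAt ℝ g x₀ ∧ ∀ᶠ x in 𝓝[≥] x₀, objective f A x = g x := by
  set p : ℝ → ℝ[X] := fun x => realCharpoly (isHermitian_family (f := f) hA x)
  have hpa : CoeffAnalyticAt p x₀ := fun i => by
    simp only [p, coeff_realCharpoly]
    exact (Complex.reCLM.analyticAt _).fun_comp
      (coeffAnalyticAt_charpoly (analyticAt_family (A := A) hf) i)
  have hn : n - 1 + 1 = n := Nat.succ_pred_eq_of_pos (NeZero.pos n)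
  have hpm : ∀ x, (p x).Monic ∧ (p x).natDegree = n - 1 + 1 := fun x =>
    ⟨realCharpoly_monic _, (realCharpoly_natDegree _).trans hn.symm⟩
  obtain ⟨g, hg, hgp⟩ := hasAnalyticTopRoot (n - 1) p hpa hpm
    (Eventually.of_forall fun x => realCharpoly_splits _)
  have hgt : ∀ᶠ x in 𝓝[>] x₀, objective f A x = g x := hgp.mono fun x hx => by
    rw [isRoot_realCharpoly] at hx
    exact (isGreatest_lamMax _).unique hx
  -- Rellich's theorem speaks of `x > x₀` only. At `x₀`, the minorant gives `≤`, and `g x₀`, a limit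
  -- of roots and hence an eigenvalue, gives `≥`.
  have hx₀ : objective f A x₀ = g x₀ := by
    refine le_antisymm ?_ ?_
    · obtain ⟨φ, hφ, hφ0, hφle⟩ := exists_minorant (f := f) hA
        (fun j => (hf j).differentiableAt)
      rw [← hφ0]
      refine le_of_tendsto_of_tendsto
        (hφ.continuousAt.tendsto.mono_left (nhdsWithin_le_nhds (s := Set.Ioi x₀)))
        (hg.continuousAt.tendsto.mono_left nhdsWithin_le_nhds) ?_
      exact hgt.mono fun x hx => hx ▸ hφle x
    · refine (isGreatest_lamMax (isHermitian_family (f := f) hA x₀)).2 ?_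
      rw [← isRoot_realCharpoly]
      have hcont : ContinuousAt (fun x => (p x).eval (g x)) x₀ :=
        (hpa.eval (fun x => (hpm x).2.le) hg).continuousAt
      refine tendsto_nhds_unique_of_eventuallyEq (g := fun _ => (0 : ℝ)) (l := 𝓝[>] x₀)
        (hcont.tendsto.mono_left nhdsWithin_le_nhds) tendsto_const_nhds ?_
      exact hgp.mono fun x hx => hx.1
  refine ⟨g, hg, ?_⟩
  rw [← Set.Ioi_insert, nhdsWithin_insert]
  exact eventually_sup.2 ⟨eventually_pure.2 hx₀, hgt⟩

theorem tendsto_neg_nhdsLE (x₀ : ℝ) : Tendsto (fun x : ℝ => -x) (𝓝[≤] x₀) (𝓝[≥] (-x₀)) :=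
  tendsto_nhdsWithin_of_tendsto_nhds_of_eventually_within _
    ((tendsto_neg x₀).mono_left nhdsWithin_le_nhds)
    (eventually_mem_nhdsWithin.mono fun x (hx : x ≤ x₀) => neg_le_neg hx)

theorem exists_analytic_left [NeZero n] {f : Fin κ → ℝ → ℝ}
    {A : Fin κ → Matrix (Fin n) (Fin n) ℂ} (hA : ∀ j, (A j).IsHermitian) {x₀ : ℝ}
    (hf : ∀ j, AnalyticAt ℝ (f j) x₀) :
    ∃ g : ℝ → ℝ, AnalyticAt ℝ g x₀ ∧ ∀ᶠ x in 𝓝[≤] x₀, objective f A x = g x := by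
  have hneg : ∀ y : ℝ, AnalyticAt ℝ (fun x : ℝ => -x) y := fun y => analyticAt_id.fun_neg
  obtain ⟨g, hg, hgF⟩ := exists_analytic_right (f := fun j x => f j (-x)) hA (x₀ := -x₀)
    fun j => AnalyticAt.fun_comp (f := fun x : ℝ => -x) (by simpa using hf j) (hneg _)
  refine ⟨fun x => g (-x), AnalyticAt.fun_comp (g := g) hg (hneg _), ?_⟩
  filter_upwards [(tendsto_neg_nhdsLE x₀).eventually hgF] with x hx
  rw [← hx]
  simp [objective, family]

end

/-! ### Convexity after subtracting the curvature -/

/-- The local structure of the largest eigenvalue of an analytic Hermitian family: one-sided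
analyticity, and a differentiable minorant that touches the function. -/
structure IsPiecewiseAnalyticAt (F : ℝ → ℝ) (x₀ : ℝ) : Prop where
  right : ∃ g : ℝ → ℝ, AnalyticAt ℝ g x₀ ∧ ∀ᶠ x in 𝓝[≥] x₀, F x = g x
  left : ∃ g : ℝ → ℝ, AnalyticAt ℝ g x₀ ∧ ∀ᶠ x in 𝓝[≤] x₀, F x = g x
  minorant : ∃ φ : ℝ → ℝ, DifferentiableAt ℝ φ x₀ ∧ φ x₀ = F x₀ ∧ ∀ x, φ x ≤ F x

theorem IsPiecewiseAnalyticAt.continuousAt {F : ℝ → ℝ} {x₀ : ℝ}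
    (h : IsPiecewiseAnalyticAt F x₀) : ContinuousAt F x₀ := by
  obtain ⟨g, hg, hgF⟩ := h.right
  obtain ⟨k, hk, hkF⟩ := h.left
  refine continuousAt_iff_continuous_left_right.2 ⟨?_, ?_⟩
  · exact hk.continuousAt.continuousWithinAt.congr_of_eventuallyEq hkF
      (hkF.self_of_nhdsWithin Set.self_mem_Iic)
  · exact hg.continuousAt.continuousWithinAt.congr_of_eventuallyEq hgF
      (hgF.self_of_nhdsWithin Set.self_mem_Ici)

theorem tendsto_neg_nhdsGE (x₀ : ℝ) : Tendsto (fun x : ℝ => -x) (𝓝[≥] (-x₀)) (𝓝[≤] x₀) :=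
  tendsto_nhdsWithin_of_tendsto_nhds_of_eventually_within _
    (by simpa using (tendsto_neg (-x₀)).mono_left (nhdsWithin_le_nhds (s := Set.Ici (-x₀))))
    (eventually_mem_nhdsWithin.mono fun x (hx : -x₀ ≤ x) => neg_le.1 hx)

theorem tendsto_neg_nhdsGT (x₀ : ℝ) : Tendsto (fun x : ℝ => -x) (𝓝[>] (-x₀)) (𝓝[<] x₀) :=
  tendsto_nhdsWithin_of_tendsto_nhds_of_eventually_within _
    (by simpa using (tendsto_neg (-x₀)).mono_left (nhdsWithin_le_nhds (s := Set.Ioi (-x₀))))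
    (eventually_mem_nhdsWithin.mono fun x (hx : -x₀ < x) => neg_lt.1 hx)

/-- A maximum principle: at the leftmost point of a positive maximum the subgradient must be `0`, so
the maximum is also attained further left. -/
theorem nonpos_of_local_subgradient {H : ℝ → ℝ} {a b : ℝ} (hH : ContinuousOn H (Set.Icc a b))
    (ha : H a ≤ 0) (hb : H b ≤ 0)
    (hloc : ∀ x ∈ Set.Ioo a b, ∃ s, ∀ᶠ y in 𝓝 x, H x + s * (y - x) ≤ H y) :
    ∀ x ∈ Set.Icc a b, H x ≤ 0 := by
  intro x hx
  by_contra! hpos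
  obtain ⟨m, hm, hmax⟩ := isCompact_Icc.exists_isMaxOn ⟨x, hx⟩ hH
  have hM : 0 < H m := hpos.trans_le (hmax hx)
  have hT : IsCompact (Set.Icc a b ∩ H ⁻¹' {H m}) :=
    isCompact_Icc.of_isClosed_subset
      (hH.preimage_isClosed_of_isClosed isClosed_Icc isClosed_singleton) Set.inter_subset_left
  obtain ⟨t, ⟨ht, htm⟩, hleast⟩ := hT.exists_isLeast ⟨m, hm, rfl⟩
  rw [Set.mem_preimage, Set.mem_singleton_iff] at htm
  have hta : a < t := lt_of_le_of_ne ht.1 fun h => by rw [← h] at htm; linarith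
  have htb : t < b := lt_of_le_of_ne ht.2 fun h => by rw [h] at htm; linarith
  obtain ⟨s, hs⟩ := hloc t ⟨hta, htb⟩
  have hev : ∀ᶠ y in 𝓝 t, y ∈ Set.Icc a b ∧ H t + s * (y - t) ≤ H y :=
    (show ∀ᶠ y in 𝓝 t, y ∈ Set.Icc a b from Icc_mem_nhds hta htb).and hs
  have hle : ∀ᶠ y in 𝓝 t, s * (y - t) ≤ 0 := hev.mono fun y hy => by
    have : H y ≤ H m := hmax hy.1
    linarith [hy.2]
  have hs0 : s = 0 := by
    refine le_antisymm ?_ ?_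
    · obtain ⟨y, hy, hty⟩ := ((hle.filter_mono (nhdsWithin_le_nhds (s := Set.Ioi t))).and
        self_mem_nhdsWithin).exists
      exact nonpos_of_mul_nonpos_left hy (sub_pos.2 hty)
    · obtain ⟨y, hy, hty⟩ := ((hle.filter_mono (nhdsWithin_le_nhds (s := Set.Iio t))).and
        self_mem_nhdsWithin).exists
      by_contra! hneg
      exact absurd hy (not_le.2 (mul_pos_of_neg_of_neg hneg (sub_neg.2 hty)))
  obtain ⟨y, ⟨hyI, hy⟩, hyt⟩ := ((hev.filter_mono (nhdsWithin_le_nhds (s := Set.Iio t))).and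
    self_mem_nhdsWithin).exists
  rw [hs0, zero_mul, add_zero, htm] at hy
  exact absurd (hleast ⟨hyI, le_antisymm (hmax hyI) hy⟩) (not_le.2 hyt)

/-- A continuous function that has a local subgradient at every interior point is convex. -/
theorem convexOn_Icc_of_local_subgradient {G : ℝ → ℝ} {a b : ℝ}
    (hG : ContinuousOn G (Set.Icc a b))
    (hloc : ∀ x ∈ Set.Ioo a b, ∃ s, ∀ᶠ y in 𝓝 x, G x + s * (y - x) ≤ G y) :
    ConvexOn ℝ (Set.Icc a b) G := by
  refine convexOn_of_slope_mono_adjacent (convex_Icc a b) fun {x y z} hx hz hxy hyz => ?_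
  have hxz := hxy.trans hyz
  set c := (G z - G x) / (z - x) with hc
  have hsub : Set.Icc x z ⊆ Set.Icc a b := Set.Icc_subset_Icc hx.1 hz.2
  have hcz : c * (z - x) = G z - G x := div_mul_cancel₀ _ (sub_pos.2 hxz).ne'
  have key := nonpos_of_local_subgradient (H := fun t => G t - (G x + c * (t - x))) (a := x)
    (b := z) ((hG.mono hsub).sub (by fun_prop)) (by simp) (by linarith)
    (fun t ht => by
      obtain ⟨s, hs⟩ := hloc t ⟨hx.1.trans_lt ht.1, ht.2.trans_le hz.2⟩
      exact ⟨s - c, hs.mono fun y hy => by nlinarith⟩) y ⟨hxy.le, hyz.le⟩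
  have h1 : (G y - G x) / (y - x) ≤ c := by
    rw [div_le_iff₀ (sub_pos.2 hxy)]; linarith
  have h2 : c ≤ (G z - G y) / (z - y) := by
    rw [le_div_iff₀ (sub_pos.2 hyz)]; linarith
  exact h1.trans h2

/-- One-sided derivatives of a function dominate the derivative of a touching minorant. -/
theorem deriv_minorant_le_right {F φ g : ℝ → ℝ} {x₀ : ℝ} (hg : DifferentiableAt ℝ g x₀)
    (hgF : ∀ᶠ x in 𝓝[≥] x₀, F x = g x) (hφ : DifferentiableAt ℝ φ x₀) (h0 : φ x₀ = F x₀)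
    (hle : ∀ x, φ x ≤ F x) : deriv φ x₀ ≤ deriv g x₀ := by
  have hgt : 𝓝[>] x₀ ≤ 𝓝[≥] x₀ := nhdsWithin_mono _ Set.Ioi_subset_Ici_self
  have h1 := (hasDerivAt_iff_tendsto_slope.1 hφ.hasDerivAt).mono_left (nhdsGT_le_nhdsNE x₀)
  have h2 := (hasDerivAt_iff_tendsto_slope.1 hg.hasDerivAt).mono_left (nhdsGT_le_nhdsNE x₀)
  refine le_of_tendsto_of_tendsto h1 h2 ?_
  have hF0 : F x₀ = g x₀ := hgF.self_of_nhdsWithin Set.self_mem_Ici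
  filter_upwards [hgF.filter_mono hgt, self_mem_nhdsWithin] with x hx hlt
  rw [slope_def_field, slope_def_field, h0, ← hF0, ← hx]
  have := hle x
  have hpos : 0 < x - x₀ := sub_pos.2 hlt
  gcongr

theorem eventuallyEq_nhds_of_eventually_nhdsGE {F g : ℝ → ℝ} {x₀ : ℝ}
    (hgF : ∀ᶠ x in 𝓝[≥] x₀, F x = g x) :
    ∀ᶠ x in 𝓝[>] x₀, F =ᶠ[𝓝 x] g := by
  have h : ∀ᶠ x in 𝓝[>] x₀, F x = g x :=
    hgF.filter_mono (nhdsWithin_mono _ Set.Ioi_subset_Ici_self)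
  exact (eventually_nhdsWithin_eventually_nhds_iff_of_isOpen isOpen_Ioi).2 h

/-- The local subgradient inequality to the right of a point, for the convexified function. -/
theorem right_subgradient {F φ : ℝ → ℝ} {x₀ γ : ℝ}
    (hr : ∃ g : ℝ → ℝ, AnalyticAt ℝ g x₀ ∧ ∀ᶠ x in 𝓝[≥] x₀, F x = g x)
    (hγ : ∀ᶠ x in 𝓝[>] x₀, DifferentiableAt ℝ F x → γ ≤ deriv (deriv F) x)
    (hφ : DifferentiableAt ℝ φ x₀) (h0 : φ x₀ = F x₀) (hle : ∀ x, φ x ≤ F x) :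
    ∀ᶠ y in 𝓝[≥] x₀, F x₀ - γ / 2 * x₀ ^ 2 + (deriv φ x₀ - γ * x₀) * (y - x₀) ≤
      F y - γ / 2 * y ^ 2 := by
  obtain ⟨g, hg, hgF⟩ := hr
  have hsl := deriv_minorant_le_right hg.differentiableAt hgF hφ h0 hle
  have hF0 : F x₀ = g x₀ := hgF.self_of_nhdsWithin Set.self_mem_Ici
  -- `k` is convex just right of `x₀`, hence above its tangent there, and that tangent is at least
  -- as steep as the minorant's slope requires.
  set k : ℝ → ℝ := fun x => g x - γ / 2 * x ^ 2 with hk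
  have hkd : ∀ x, AnalyticAt ℝ g x → HasDerivAt k (deriv g x - γ * x) x := fun x hx => by
    have := hx.differentiableAt.hasDerivAt.sub (((hasDerivAt_id x).pow 2).const_mul (γ / 2))
    convert! this using 1
    simp only [id]
    ring
  have hγ' : ∀ᶠ x in 𝓝[>] x₀, γ ≤ deriv (deriv g) x := by
    filter_upwards [hγ, eventuallyEq_nhds_of_eventually_nhdsGE hgF,
      hg.eventually_analyticAt.filter_mono nhdsWithin_le_nhds] with x h1 h2 h3
    rw [← h2.deriv.deriv_eq]
    exact h1 (h3.differentiableAt.congr_of_eventuallyEq h2)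
  obtain ⟨u, hu, hu1⟩ := mem_nhdsGT_iff_exists_Ioo_subset.1 hγ'
  obtain ⟨v, hv, hv1⟩ := (mem_nhdsGE_iff_exists_Ico_subset' (lt_add_one x₀)).1
    ((hg.eventually_analyticAt.filter_mono nhdsWithin_le_nhds).and hgF)
  set D := Set.Ico x₀ (min u v)
  have hDan : ∀ x ∈ D, AnalyticAt ℝ g x := fun x hx =>
    (hv1 ⟨hx.1, hx.2.trans_le (min_le_right _ _)⟩).1
  have hDF : ∀ x ∈ D, F x = g x := fun x hx =>
    (hv1 ⟨hx.1, hx.2.trans_le (min_le_right _ _)⟩).2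
  have hD0 : x₀ ∈ D := ⟨le_rfl, lt_min hu hv⟩
  have hint : interior D = Set.Ioo x₀ (min u v) := interior_Ico
  have hkd' : ∀ x ∈ interior D, deriv k =ᶠ[𝓝 x] fun x => deriv g x - γ * x := fun x hx =>
    (hDan x (interior_subset hx)).eventually_analyticAt.mono fun y hy => (hkd y hy).deriv
  have hkd2 : ∀ x ∈ interior D, HasDerivAt (deriv k) (deriv (deriv g) x - γ) x := fun x hx => by
    refine HasDerivAt.congr_of_eventuallyEq ?_ (hkd' x hx)
    have := (hDan x (interior_subset hx)).deriv.differentiableAt.hasDerivAt.sub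
      ((hasDerivAt_id x).const_mul γ)
    rwa [mul_one] at this
  have hconv : ConvexOn ℝ D k := by
    refine convexOn_of_deriv2_nonneg (convex_Ico _ _)
      (fun x hx => (hkd x (hDan x hx)).continuousAt.continuousWithinAt)
      (fun x hx => (hkd x (hDan x (interior_subset hx))).differentiableAt.differentiableWithinAt)
      (fun x hx => (hkd2 x hx).differentiableAt.differentiableWithinAt) fun x hx => ?_
    rw [Function.iterate_succ, Function.iterate_one, Function.comp_apply, (hkd2 x hx).deriv]
    rw [hint] at hx
    exact sub_nonneg.2 (hu1 ⟨hx.1, hx.2.trans_le (min_le_left _ _)⟩)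
  filter_upwards [Ico_mem_nhdsGE (lt_min hu hv)] with y hy
  rcases hy.1.eq_or_lt with rfl | hlt
  · simp
  have h1 := hconv.le_slope_of_hasDerivAt hD0 hy hlt (hkd x₀ hg)
  rw [slope_def_field, le_div_iff₀ (sub_pos.2 hlt)] at h1
  simp only [hk] at h1
  rw [hF0, hDF y hy]
  nlinarith [mul_le_mul_of_nonneg_right hsl (sub_pos.2 hlt).le]

theorem left_subgradient {F φ : ℝ → ℝ} {x₀ γ : ℝ}
    (hr : ∃ g : ℝ → ℝ, AnalyticAt ℝ g x₀ ∧ ∀ᶠ x in 𝓝[≤] x₀, F x = g x)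
    (hγ : ∀ᶠ x in 𝓝[<] x₀, DifferentiableAt ℝ F x → γ ≤ deriv (deriv F) x)
    (hφ : DifferentiableAt ℝ φ x₀) (h0 : φ x₀ = F x₀) (hle : ∀ x, φ x ≤ F x) :
    ∀ᶠ y in 𝓝[≤] x₀, F x₀ - γ / 2 * x₀ ^ 2 + (deriv φ x₀ - γ * x₀) * (y - x₀) ≤
      F y - γ / 2 * y ^ 2 := by
  obtain ⟨g, hg, hgF⟩ := hr
  have hneg : AnalyticAt ℝ (fun x : ℝ => -x) (-x₀) := analyticAt_id.fun_neg
  have hd2 : ∀ x, deriv (deriv fun x => F (-x)) x = deriv (deriv F) (-x) := fun x => by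
    have : (deriv fun x => F (-x)) = fun x => -deriv F (-x) := by
      exact funext (deriv_comp_neg F)
    rw [this, deriv.fun_neg, deriv_comp_neg, neg_neg]
  have := right_subgradient (F := fun x => F (-x)) (φ := fun x => φ (-x)) (x₀ := -x₀) (γ := γ)
    ⟨fun x => g (-x), AnalyticAt.fun_comp (g := g) (by simpa using hg) hneg,
      (tendsto_neg_nhdsGE x₀).eventually hgF⟩
    (by
      filter_upwards [(tendsto_neg_nhdsGT x₀).eventually hγ] with x hx hd
      rw [hd2]
      exact hx (differentiableAt_comp_neg.1 hd))
    (differentiableAt_comp_neg.2 (by simpa using hφ)) (by simpa using h0) (fun x => hle _)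
  filter_upwards [(tendsto_neg_nhdsLE x₀).eventually this] with y hy
  rw [deriv_comp_neg] at hy
  simp only [neg_neg, neg_sq] at hy
  linarith

/-- A curvature bound makes the function convex after subtraction of the quadratic. -/
theorem convexOn_sub_sq {F : ℝ → ℝ} {a b γ : ℝ}
    (hF : ∀ x ∈ Set.Icc a b, IsPiecewiseAnalyticAt F x)
    (hγ : IsCurvatureBound F (Set.Icc a b) γ) :
    ConvexOn ℝ (Set.Icc a b) fun x => F x - γ / 2 * x ^ 2 := by
  refine convexOn_Icc_of_local_subgradient (fun x hx =>
    ((hF x hx).continuousAt.sub (by fun_prop)).continuousWithinAt) fun x hx => ?_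
  obtain ⟨hr, hl, φ, hφ, h0, hle⟩ := hF x ⟨hx.1.le, hx.2.le⟩
  have hev : ∀ᶠ y in 𝓝 x, DifferentiableAt ℝ F y → γ ≤ deriv (deriv F) y := by
    filter_upwards [Icc_mem_nhds hx.1 hx.2] with y hy using hγ.2 y hy
  -- The minorant supplies one slope valid on both sides, even at a kink.
  refine ⟨deriv φ x - γ * x, ?_⟩
  rw [← nhdsLE_sup_nhdsGE]
  exact eventually_sup.2 ⟨left_subgradient hl (hev.filter_mono nhdsWithin_le_nhds) hφ h0 hle,
    right_subgradient hr (hev.filter_mono nhdsWithin_le_nhds) hφ h0 hle⟩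

/-! ### One-sided derivatives and the kink -/

theorem hasDerivWithinAt_of_eventually_eq {F g : ℝ → ℝ} {w : ℝ} {s : Set ℝ} (hws : w ∈ s)
    (hg : DifferentiableAt ℝ g w) (hgF : ∀ᶠ x in 𝓝[s] w, F x = g x) :
    HasDerivWithinAt F (deriv g w) s w :=
  hg.hasDerivAt.hasDerivWithinAt.congr_of_eventuallyEq hgF (hgF.self_of_nhdsWithin hws)

theorem deriv_eq_right_or_left {F g h : ℝ → ℝ} {w : ℝ} (hg : DifferentiableAt ℝ g w)
    (hgF : ∀ᶠ x in 𝓝[≥] w, F x = g x) (hhF : ∀ᶠ x in 𝓝[≤] w, F x = h x) :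
    ∀ᶠ x in 𝓝 w, DifferentiableAt ℝ F x →
      (F x = g x ∧ deriv F x = deriv g x) ∨ (F x = h x ∧ deriv F x = deriv h x) := by
  have hright : ∀ᶠ x in 𝓝[>] w, F =ᶠ[𝓝 x] g := eventuallyEq_nhds_of_eventually_nhdsGE hgF
  have hleft : ∀ᶠ x in 𝓝[<] w, F =ᶠ[𝓝 x] h :=
    (eventually_nhdsWithin_eventually_nhds_iff_of_isOpen isOpen_Iio).2
      (hhF.filter_mono (nhdsWithin_mono _ Set.Iio_subset_Iic_self))
  rw [← nhdsLT_sup_nhdsGE, eventually_sup]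
  refine ⟨hleft.mono fun x hx _ => Or.inr ⟨hx.eq_of_nhds, hx.deriv_eq⟩, ?_⟩
  rw [← Set.Ioi_insert, nhdsWithin_insert, eventually_sup]
  refine ⟨eventually_pure.2 fun hd => Or.inl ⟨hgF.self_of_nhdsWithin Set.self_mem_Ici, ?_⟩,
    hright.mono fun x hx _ => Or.inl ⟨hx.eq_of_nhds, hx.deriv_eq⟩⟩
  exact (uniqueDiffOn_Ici w w Set.self_mem_Ici).eq_deriv _ hd.hasDerivAt.hasDerivWithinAt
    (hasDerivWithinAt_of_eventually_eq Set.self_mem_Ici hg hgF)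

/-- Near any point, the derivatives of a piecewise analytic function are bounded. -/
theorem IsPiecewiseAnalyticAt.exists_deriv_bound {F : ℝ → ℝ} {x₀ : ℝ}
    (h : IsPiecewiseAnalyticAt F x₀) :
    ∃ L, ∀ᶠ x in 𝓝 x₀, DifferentiableAt ℝ F x → |deriv F x| ≤ L := by
  obtain ⟨g, hg, hgF⟩ := h.right
  obtain ⟨k, hk, hkF⟩ := h.left
  refine ⟨max (|deriv g x₀| + 1) (|deriv k x₀| + 1), ?_⟩
  filter_upwards [deriv_eq_right_or_left hg.differentiableAt hgF hkF,
    hg.deriv.continuousAt.abs.eventually_lt_const (lt_add_one _),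
    hk.deriv.continuousAt.abs.eventually_lt_const (lt_add_one _)] with x h1 h2 h3 hd
  rcases h1 hd with ⟨-, e⟩ | ⟨-, e⟩ <;> rw [e]
  · exact h2.le.trans (le_max_left _ _)
  · exact h3.le.trans (le_max_right _ _)

/-- Second order error of the tangent lines of an analytic function, evaluated at a fixed
point. -/
theorem exists_tangent_error_bound {g : ℝ → ℝ} {w : ℝ} (hg : AnalyticAt ℝ g w) :
    ∃ C, ∀ᶠ y in 𝓝 w, |g w - g y - deriv g y * (w - y)| ≤ C * (w - y) ^ 2 := by
  set R : ℝ → ℝ := fun y => g w - g y - deriv g y * (w - y) with hR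
  have hRa : AnalyticAt ℝ R w := (analyticAt_const.fun_sub hg).fun_sub
    (hg.deriv.fun_mul (analyticAt_const.fun_sub analyticAt_id))
  have hR0 : R w = 0 := by simp [hR]
  -- The derivative of `R` at `y` is `-g''(y) * (w - y)`, so `R` vanishes to second order at `w`.
  have hR1 : deriv R w = 0 := by
    have h1 := (hg.differentiableAt.hasDerivAt.const_sub (g w)).sub
      (hg.deriv.differentiableAt.hasDerivAt.mul ((hasDerivAt_id w).const_sub w))
    have h2 : HasDerivAt R 0 w := by
      convert! h1 using 1
      simp
    exact h2.deriv
  have hord : ((2 : ℕ) : ℕ∞) ≤ analyticOrderAt R w := by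
    rw [natCast_le_analyticOrderAt_iff_iteratedDeriv_eq_zero hRa]
    intro i hi
    interval_cases i
    · simpa using hR0
    · simpa using hR1
  obtain ⟨k, hk, hRk⟩ := (natCast_le_analyticOrderAt hRa).1 hord
  refine ⟨|k w| + 1, ?_⟩
  filter_upwards [hRk, hk.continuousAt.abs.eventually_lt_const (lt_add_one _)] with y h1 h2
  have h3 : g w - g y - deriv g y * (w - y) = (y - w) ^ 2 * k y := h1
  rw [h3, abs_mul, abs_pow, sq_abs, mul_comm, sub_sq_comm]
  gcongr

/-- Near `w` each derivative of `F` is one of `g` or of `h`; a product of two differences records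
this and passes to the limit. -/
theorem clarkeDeriv_subset_Icc {F g h : ℝ → ℝ} {w : ℝ} (hg : AnalyticAt ℝ g w)
    (hgF : ∀ᶠ x in 𝓝[≥] w, F x = g x) (hh : AnalyticAt ℝ h w) (hhF : ∀ᶠ x in 𝓝[≤] w, F x = h x)
    (hle : deriv h w ≤ deriv g w) : clarkeDeriv F w ⊆ Set.Icc (deriv h w) (deriv g w) := by
  refine convexHull_min ?_ (convex_Icc _ _)
  rintro v ⟨x, hx, hxd, hv⟩
  have h1 : ∀ᶠ k in atTop,
      (deriv F (x k) - deriv g (x k)) * (deriv F (x k) - deriv h (x k)) = 0 := by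
    filter_upwards [hx.eventually (deriv_eq_right_or_left hg.differentiableAt hgF hhF)] with k hk
    rcases hk (hxd k) with ⟨-, e⟩ | ⟨-, e⟩ <;> simp [e]
  have h2 := (hv.sub (hg.deriv.continuousAt.tendsto.comp hx)).mul
    (hv.sub (hh.deriv.continuousAt.tendsto.comp hx))
  have h3 : (v - deriv g w) * (v - deriv h w) = 0 :=
    tendsto_nhds_unique_of_eventuallyEq h2 tendsto_const_nhds h1
  rcases mul_eq_zero.1 h3 with h | h
  · rw [sub_eq_zero.1 h]; exact Set.right_mem_Icc.2 hle
  · rw [sub_eq_zero.1 h]; exact Set.left_mem_Icc.2 hle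

/-- At a point whose Clarke derivative contains `0` in its interior, a piecewise analytic function
has a sharp kink, and its tangents are accurate to second order on both sides. -/
theorem exists_kink {F : ℝ → ℝ} {w : ℝ} (hF : IsPiecewiseAnalyticAt F w)
    (h0 : (0 : ℝ) ∈ interior (clarkeDeriv F w)) :
    ∃ α β C : ℝ, 0 < α ∧ 0 < β ∧ HasDerivWithinAt F (-α) (Set.Iio w) w ∧
      HasDerivWithinAt F β (Set.Ioi w) w ∧
      ∀ᶠ y in 𝓝 w, DifferentiableAt ℝ F y →
        |F w - F y - deriv F y * (w - y)| ≤ C * (w - y) ^ 2 := by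
  obtain ⟨⟨g, hg, hgF⟩, ⟨h, hh, hhF⟩, φ, hφ, hφ0, hφle⟩ := hF
  have hFg : F w = g w := hgF.self_of_nhdsWithin Set.self_mem_Ici
  have hFh : F w = h w := hhF.self_of_nhdsWithin Set.self_mem_Iic
  have hdg := hasDerivWithinAt_of_eventually_eq Set.self_mem_Ici hg.differentiableAt hgF
  have hdh := hasDerivWithinAt_of_eventually_eq Set.self_mem_Iic hh.differentiableAt hhF
  have hφg : deriv φ w ≤ deriv g w :=
    deriv_minorant_le_right hg.differentiableAt hgF hφ hφ0 hφle
  have hφh : deriv h w ≤ deriv φ w := by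
    have := deriv_minorant_le_right (F := fun x => F (-x)) (φ := fun x => φ (-x))
      (g := fun x => h (-x)) (x₀ := -w)
      (differentiableAt_comp_neg.2 (by simpa using hh.differentiableAt))
      ((tendsto_neg_nhdsGE w).eventually hhF) (differentiableAt_comp_neg.2 (by simpa using hφ))
      (by simpa using hφ0) (fun x => hφle _)
    rw [deriv_comp_neg, deriv_comp_neg, neg_neg] at this
    linarith
  have hint := interior_mono
    (clarkeDeriv_subset_Icc hg hgF hh hhF (hφh.trans hφg)) h0
  rw [interior_Icc] at hint
  obtain ⟨C₁, hC₁⟩ := exists_tangent_error_bound hg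
  obtain ⟨C₂, hC₂⟩ := exists_tangent_error_bound hh
  refine ⟨-deriv h w, deriv g w, max C₁ C₂, neg_pos.2 hint.1, hint.2,
    by simpa using hdh.mono Set.Iio_subset_Iic_self, hdg.mono Set.Ioi_subset_Ici_self, ?_⟩
  filter_upwards [deriv_eq_right_or_left hg.differentiableAt hgF hhF, hC₁, hC₂]
    with y h1 h2 h3 hd
  rcases h1 hd with ⟨e, e'⟩ | ⟨e, e'⟩
  · rw [e', e, hFg]
    exact h2.trans (by gcongr; exact le_max_left _ _)
  · rw [e', e, hFh]
    exact h3.trans (by gcongr; exact le_max_right _ _)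

/-! ### Support functions from convexity -/

/-- The support functions are global lower bounds. -/
theorem support_le {F : ℝ → ℝ} {a b γ y x : ℝ}
    (hconv : ConvexOn ℝ (Set.Icc a b) fun x => F x - γ / 2 * x ^ 2)
    (hy : y ∈ Set.Icc a b) (hd : DifferentiableAt ℝ F y) (hx : x ∈ Set.Icc a b) :
    support F γ y x ≤ F x := by
  -- The tangent of this convex function at `y`, plus `γ / 2 * x ^ 2`, is exactly `support F γ y x`.
  have hG : HasDerivAt (fun x => F x - γ / 2 * x ^ 2) (deriv F y - γ * y) y := by
    have := hd.hasDerivAt.sub (((hasDerivAt_id y).pow 2).const_mul (γ / 2))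
    convert! this using 1
    simp only [id]
    ring
  rw [support]
  rcases lt_trichotomy x y with h | rfl | h
  · have := hconv.slope_le_of_hasDerivAt hx hy h hG
    rw [slope_def_field, div_le_iff₀ (sub_pos.2 h)] at this
    nlinarith
  · simp
  · have := hconv.le_slope_of_hasDerivAt hy hx h hG
    rw [slope_def_field, le_div_iff₀ (sub_pos.2 h)] at this
    nlinarith

/-- At a kink, the slopes of all support functions from the right are bounded below by the
right derivative. -/
theorem le_support_slope_of_right {F : ℝ → ℝ} {a b γ w β y : ℝ}
    (hconv : ConvexOn ℝ (Set.Icc a b) fun x => F x - γ / 2 * x ^ 2)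
    (hw : w ∈ Set.Icc a b) (hβ : HasDerivWithinAt F β (Set.Ioi w) w)
    (hy : y ∈ Set.Icc a b) (hd : DifferentiableAt ℝ F y) (hwy : w < y) :
    β ≤ deriv F y + γ * (w - y) := by
  have h1 : HasDerivWithinAt (fun x => F x - γ / 2 * x ^ 2) (β - γ * w) (Set.Ioi w) w := by
    have := hβ.sub ((((hasDerivAt_id w).pow 2).const_mul (γ / 2)).hasDerivWithinAt)
    convert! this using 1
    simp only [id]
    ring
  have h2 := hconv.le_slope_of_hasDerivWithinAt_Ioi hw hy hwy h1
  rw [slope_def_field, le_div_iff₀ (sub_pos.2 hwy)] at h2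
  have h3 := support_le hconv hy hd hw
  rw [support] at h3
  have hpos := sub_pos.2 hwy
  refine le_of_mul_le_mul_right ?_ hpos
  nlinarith

theorem support_slope_le_of_left {F : ℝ → ℝ} {a b γ w α y : ℝ}
    (hconv : ConvexOn ℝ (Set.Icc a b) fun x => F x - γ / 2 * x ^ 2)
    (hw : w ∈ Set.Icc a b) (hα : HasDerivWithinAt F (-α) (Set.Iio w) w)
    (hy : y ∈ Set.Icc a b) (hd : DifferentiableAt ℝ F y) (hyw : y < w) :
    deriv F y + γ * (w - y) ≤ -α := by
  have h1 : HasDerivWithinAt (fun x => F x - γ / 2 * x ^ 2) (-α - γ * w) (Set.Iio w) w := by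
    have := hα.sub ((((hasDerivAt_id w).pow 2).const_mul (γ / 2)).hasDerivWithinAt)
    convert! this using 1
    simp only [id]
    ring
  have h2 := hconv.slope_le_of_hasDerivWithinAt_Iio hy hw hyw h1
  rw [slope_def_field, div_le_iff₀ (sub_pos.2 hyw)] at h2
  have h3 := support_le hconv hy hd hw
  rw [support] at h3
  have hpos := sub_pos.2 hyw
  refine le_of_mul_le_mul_right ?_ hpos
  nlinarith

/-! ### The algorithm near a sharp minimizer -/

section

variable {F : ℝ → ℝ} {Ω : Set ℝ} {γ w c η C : ℝ} {ω l : ℕ → ℝ}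

theorem continuous_support (F : ℝ → ℝ) (γ y : ℝ) : Continuous (support F γ y) := by
  unfold support
  fun_prop

theorem support_self (F : ℝ → ℝ) (γ y : ℝ) : support F γ y y = F y := by
  simp [support]

theorem support_le_model {j k : ℕ} (h : j ≤ k) (x : ℝ) :
    support F γ (ω j) x ≤ model F γ ω k x :=
  Finset.le_sup' (fun j => support F γ (ω j) x) (Finset.mem_range.2 (Nat.lt_succ_of_le h))

theorem model_le {k : ℕ} {x M : ℝ} (h : ∀ j ≤ k, support F γ (ω j) x ≤ M) :
    model F γ ω k x ≤ M :=
  Finset.sup'_le _ _ fun j hj => h j (Nat.le_of_lt_succ (Finset.mem_range.1 hj))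

theorem model_lt {k : ℕ} {x M : ℝ} (h : ∀ j ≤ k, support F γ (ω j) x < M) :
    model F γ ω k x < M :=
  (Finset.sup'_lt_iff _).2 fun j hj => h j (Nat.le_of_lt_succ (Finset.mem_range.1 hj))

/-- The properties of the support functions about the iterates `ω` near a sharp minimizer `w`:
on each side of `w` (encoded by a sign `σ`), all support functions have slopes bounded away from
zero, and those about nearby points are accurate to second order at `w`. -/
structure IsSharpAt (F : ℝ → ℝ) (Ω : Set ℝ) (γ w c η C : ℝ) (ω : ℕ → ℝ) : Prop where
  c_pos : 0 < c
  η_pos : 0 < η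
  C_nonneg : 0 ≤ C
  convex : Convex ℝ Ω
  w_mem : w ∈ Ω
  min : ∀ x ∈ Ω, x ≠ w → F w < F x
  ne : ∀ k, ω k ≠ w
  support_le : ∀ j, ∀ x ∈ Ω, support F γ (ω j) x ≤ F x
  slope : ∀ σ : ℝ, (σ = 1 ∨ σ = -1) → ∀ j, 0 < σ * (ω j - w) → ∀ x y, |x - w| ≤ η →
    |y - w| ≤ η → σ * x ≤ σ * y →
      support F γ (ω j) x + c * (σ * (y - x)) ≤ support F γ (ω j) y
  quad : ∀ j, |ω j - w| ≤ η → F w - C * (ω j - w) ^ 2 ≤ support F γ (ω j) w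

theorem sign_neg {σ : ℝ} (hσ : σ = 1 ∨ σ = -1) : -σ = 1 ∨ -σ = -1 := by
  rcases hσ with rfl | rfl <;> simp

theorem abs_eq_of_sign {σ x : ℝ} (hσ : σ = 1 ∨ σ = -1) (h : 0 < σ * x) : |x| = σ * x := by
  rcases hσ with rfl | rfl
  · rw [one_mul] at h ⊢; exact abs_of_pos h
  · rw [neg_one_mul] at h ⊢; exact abs_of_neg (neg_pos.1 h)

theorem exists_sign {x : ℝ} (h : x ≠ 0) : ∃ σ : ℝ, (σ = 1 ∨ σ = -1) ∧ 0 < σ * x := by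
  rcases h.lt_or_gt with h | h
  · exact ⟨-1, Or.inr rfl, by linarith⟩
  · exact ⟨1, Or.inl rfl, by linarith⟩

theorem sign_cases {σ x : ℝ} (hσ : σ = 1 ∨ σ = -1) (h : x ≠ 0) : 0 < σ * x ∨ 0 < -σ * x := by
  rcases hσ with rfl | rfl <;> rcases h.lt_or_gt with h | h
  · right; linarith
  · left; linarith
  · left; linarith
  · right; linarith

theorem IsRun.lower_mono (hr : IsRun F Ω γ ω l) (k : ℕ) : l (k + 1) ≤ l (k + 2) := by
  rw [hr.lower, hr.lower]
  exact (hr.isMin k (hr.mem _)).trans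
    (model_le fun j hj => support_le_model (hj.trans k.le_succ) _)

namespace IsSharpAt

/-- Second-order accuracy at `w`, then growth at rate `c` from `w` out to `ω k`. -/
theorem le_support_of_same_side (hs : IsSharpAt F Ω γ w c η C ω) {σ : ℝ}
    (hσ : σ = 1 ∨ σ = -1) {j k : ℕ} (hj : |ω j - w| ≤ η) (hk : |ω k - w| ≤ η) (hjpos : 0 < σ * (ω j - w))
    (hpos : 0 < σ * (ω k - w)) :
    F w - C * (ω j - w) ^ 2 + c * |ω k - w| ≤ support F γ (ω j) (ω k) := by
  have h1 := hs.slope σ hσ j hjpos w (ω k) (by simpa using hs.η_pos.le) hk (by linarith)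
  rw [abs_eq_of_sign hσ hpos]
  linarith [hs.quad j hj]

variable (hs : IsSharpAt F Ω γ w c η C ω) (hr : IsRun F Ω γ ω l)
include hs hr

theorem lower_le (k : ℕ) : l (k + 1) ≤ F w := by
  rw [hr.lower]
  exact (hr.isMin k hs.w_mem).trans (model_le fun j _ => hs.support_le j w hs.w_mem)

/-- At a new iterate on one side of `w`, a support function about an iterate on the other side is
active. -/
theorem exists_active {σ : ℝ} (hσ : σ = 1 ∨ σ = -1) {k : ℕ} (hk : |ω (k + 1) - w| ≤ η)
    (hpos : 0 < σ * (ω (k + 1) - w)) :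
    ∃ j ≤ k, 0 < -σ * (ω j - w) ∧ support F γ (ω j) (ω (k + 1)) = l (k + 1) := by
  by_contra! hno
  set u := ω (k + 1)
  -- On a small step from `u` towards `w`, same-side support functions strictly decrease, and the
  -- others, inactive at `u`, stay below by continuity. The model would drop below its minimum.
  have hlt : ∀ j ≤ k, ∀ᶠ t : ℝ in 𝓝[>] 0, support F γ (ω j) (u + t * (w - u)) < l (k + 1) := by
    intro j hj
    have hle : support F γ (ω j) u ≤ l (k + 1) := by
      rw [hr.lower]; exact support_le_model hj _
    rcases sign_cases hσ (sub_ne_zero.2 (hs.ne j)) with h | h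
    · filter_upwards [Ioo_mem_nhdsGT (zero_lt_one' ℝ)] with t ht
      have e1 : u + t * (w - u) - w = (1 - t) * (u - w) := by ring
      have h1 : |u + t * (w - u) - w| ≤ η := by
        rw [e1, abs_mul, abs_of_pos (sub_pos.2 ht.2)]
        exact (mul_le_of_le_one_left (abs_nonneg _) (by linarith [ht.1])).trans hk
      have h2 : 0 < t * (σ * (u - w)) := mul_pos ht.1 hpos
      have h3 := hs.slope σ hσ j h (u + t * (w - u)) u h1 hk (by linarith)
      have h4 : 0 < c * (σ * (u - (u + t * (w - u)))) := mul_pos hs.c_pos (by linarith)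
      linarith
    · have hc : Continuous fun t : ℝ => support F γ (ω j) (u + t * (w - u)) :=
        (continuous_support F γ (ω j)).comp (by fun_prop)
      refine (hc.continuousAt.eventually_lt_const ?_).filter_mono nhdsWithin_le_nhds
      simpa using lt_of_le_of_ne hle (hno j hj h)
  have hall : ∀ᶠ t : ℝ in 𝓝[>] 0, ∀ j ∈ Finset.range (k + 1),
      support F γ (ω j) (u + t * (w - u)) < l (k + 1) :=
    (Finset.eventually_all _).2 fun j hj =>
      hlt j (Nat.le_of_lt_succ (Finset.mem_range.1 hj))
  obtain ⟨t, ht, ht0, ht1⟩ := (hall.and (Ioo_mem_nhdsGT (zero_lt_one' ℝ))).exists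
  have hmem : u + t * (w - u) ∈ Ω :=
    hs.convex.add_smul_sub_mem (hr.mem _) hs.w_mem ⟨ht0.le, ht1.le⟩
  have h1 : l (k + 1) ≤ model F γ ω k (u + t * (w - u)) := by
    rw [hr.lower]; exact hr.isMin k hmem
  exact absurd h1 (not_le.2 (model_lt fun j hj => ht j (Finset.mem_range.2 (by omega))))

/-- The active support function from the other side climbs from `l (k + 1)` at rate `c` on the way
to `w`, where it is at most `F w`. -/
theorem mul_abs_le_sub_lower {k : ℕ} (hk : |ω (k + 1) - w| ≤ η) :
    c * |ω (k + 1) - w| ≤ F w - l (k + 1) := by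
  obtain ⟨σ, hσ, hpos⟩ := exists_sign (sub_ne_zero.2 (hs.ne (k + 1)))
  obtain ⟨j, -, hj, hjl⟩ := hs.exists_active hr hσ hk hpos
  have h1 := hs.slope (-σ) (sign_neg hσ) j hj (ω (k + 1)) w hk (by simpa using hs.η_pos.le)
    (by linarith)
  have h2 := hs.support_le j w hs.w_mem
  rw [abs_eq_of_sign hσ hpos]
  linarith

/-- The basic recursion: the new lower bound and the new error are controlled by the squares of
the last two errors. -/
theorem add_mul_abs_le_lower {k : ℕ} (h0 : |ω k - w| ≤ η) (h1 : |ω (k + 1) - w| ≤ η)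
    (h2 : |ω (k + 2) - w| ≤ η) :
    F w - C * (max |ω (k + 1) - w| |ω k - w|) ^ 2 + c * |ω (k + 2) - w| ≤ l (k + 2) := by
  have hsq : ∀ x : ℝ, |x| ≤ max |ω (k + 1) - w| |ω k - w| →
      C * x ^ 2 ≤ C * (max |ω (k + 1) - w| |ω k - w|) ^ 2 := fun x hx => by
    rw [← sq_abs x]
    have := hs.C_nonneg
    gcongr
  have hsq0 := hsq (ω k - w) (le_max_right _ _)
  have hsq1 := hsq (ω (k + 1) - w) (le_max_left _ _)
  have hle : ∀ j ≤ k + 1, support F γ (ω j) (ω (k + 2)) ≤ l (k + 2) := fun j hj => by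
    rw [hr.lower]; exact support_le_model hj _
  obtain ⟨σ, hσ, hpos⟩ := exists_sign (sub_ne_zero.2 (hs.ne (k + 2)))
  rcases sign_cases hσ (sub_ne_zero.2 (hs.ne (k + 1))) with hp1 | hp1
  · linarith [hs.le_support_of_same_side hσ h1 h2 hp1 hpos, hle (k + 1) le_rfl]
  rcases sign_cases hσ (sub_ne_zero.2 (hs.ne k)) with hp0 | hp0
  · linarith [hs.le_support_of_same_side hσ h0 h2 hp0 hpos, hle k k.le_succ]
  -- Both previous iterates lie opposite to `ω (k + 2)`. The support function active at `ω (k + 1)`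
  -- comes from the side of `ω (k + 2)` and grows towards it, while `ω k` bounds its starting value
  -- `l (k + 1)` from below.
  obtain ⟨j, hjk, hj, hjl⟩ := hs.exists_active hr (sign_neg hσ) h1 hp1
  rw [neg_neg] at hj
  have e1 := hs.le_support_of_same_side (sign_neg hσ) h0 h1 hp0 hp1
  have e2 : support F γ (ω k) (ω (k + 1)) ≤ l (k + 1) := by
    rw [hr.lower]; exact support_le_model le_rfl _
  have e3 := hs.slope σ hσ j hj (ω (k + 1)) (ω (k + 2)) h1 h2 (by linarith)
  have e4 := hle j (hjk.trans k.le_succ)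
  have e5 : 0 ≤ c * |ω (k + 1) - w| := mul_nonneg hs.c_pos.le (abs_nonneg _)
  have e6 : c * |ω (k + 2) - w| ≤ c * (σ * (ω (k + 2) - ω (k + 1))) := by
    rw [abs_eq_of_sign hσ hpos]
    exact mul_le_mul_of_nonneg_left (by linarith) hs.c_pos.le
  linarith

/-- A new iterate near `w` is strictly closer to `w` than all earlier ones on its side. -/
theorem lt_of_same_side {σ : ℝ} (hσ : σ = 1 ∨ σ = -1) {j k : ℕ} (hjk : j ≤ k)
    (hk : |ω (k + 1) - w| ≤ η) (hpos : 0 < σ * (ω (k + 1) - w)) (hjpos : 0 < σ * (ω j - w)) :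
    σ * ω (k + 1) < σ * ω j := by
  -- Otherwise `ω j` lies between `w` and the new iterate, and its support function there is at
  -- least `F (ω j) > F w ≥ l (k + 1)`.
  by_contra! hle
  have hj : |ω j - w| ≤ η := by
    rw [abs_eq_of_sign hσ hjpos]
    rw [abs_eq_of_sign hσ hpos] at hk
    linarith
  have h1 := hs.slope σ hσ j hjpos (ω j) (ω (k + 1)) hj hk hle
  have h2 : support F γ (ω j) (ω (k + 1)) ≤ l (k + 1) := by
    rw [hr.lower]; exact support_le_model hjk _
  have h3 := hs.lower_le hr k
  have h4 := hs.min (ω j) (hr.mem j) (hs.ne j)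
  have h5 : 0 ≤ c * (σ * (ω (k + 1) - ω j)) := mul_nonneg hs.c_pos.le (by linarith)
  rw [support_self] at h1
  linarith

theorem nearest {k : ℕ} (hk : |ω (k + 1) - w| ≤ η) :
    (∀ j, IsLeftNearest ω w (k + 1) j ↔ j = k + 1) ∨
      (∀ j, IsRightNearest ω w (k + 1) j ↔ j = k + 1) := by
  rcases (hs.ne (k + 1)).lt_or_gt with h | h
  · left
    have key : ∀ i ≤ k, ω i < w → ω i < ω (k + 1) := fun i hi hiw => by
      have := hs.lt_of_same_side hr (Or.inr rfl) hi hk (by linarith) (by linarith)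
      linarith
    refine fun j => ⟨fun ⟨hj, hjw, hjm⟩ => ?_, ?_⟩
    · by_contra hne
      have := key j (by omega) hjw
      linarith [hjm (k + 1) le_rfl h]
    · rintro rfl
      refine ⟨le_rfl, h, fun i hi hiw => ?_⟩
      rcases hi.eq_or_lt with rfl | hlt
      · exact le_rfl
      · linarith [key i (by omega) hiw]
  · right
    have key : ∀ i ≤ k, w < ω i → ω (k + 1) < ω i := fun i hi hiw => by
      have := hs.lt_of_same_side hr (Or.inl rfl) hi hk (by linarith) (by linarith)
      linarith
    refine fun j => ⟨fun ⟨hj, hjw, hjm⟩ => ?_, ?_⟩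
    · by_contra hne
      have := key j (by omega) hjw
      linarith [hjm (k + 1) le_rfl h]
    · rintro rfl
      refine ⟨le_rfl, h, fun i hi hiw => ?_⟩
      rcases hi.eq_or_lt with rfl | hlt
      · exact le_rfl
      · linarith [key i (by omega) hiw]

theorem isBigO_error (ht : Tendsto ω atTop (𝓝 w)) :
    (fun k => |ω (k + 2) - w|) =O[atTop] fun k => (max |ω (k + 1) - w| |ω k - w|) ^ 2 := by
  have hev : ∀ᶠ k in atTop, |ω k - w| ≤ η :=
    (Metric.tendsto_nhds.1 ht η hs.η_pos).mono fun k hk => hk.le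
  refine IsBigO.of_bound (C / c) ?_
  filter_upwards [hev, (tendsto_add_atTop_nat 1).eventually hev,
    (tendsto_add_atTop_nat 2).eventually hev] with k h0 h1 h2
  have e1 := hs.add_mul_abs_le_lower hr h0 h1 h2
  have e2 := hs.lower_le hr (k + 1)
  rw [Real.norm_of_nonneg (abs_nonneg _), Real.norm_of_nonneg (by positivity), div_mul_eq_mul_div,
    le_div_iff₀ hs.c_pos]
  linarith

/-- In the basic recursion both errors are turned into gaps; since `l` increases, the older gap
dominates. -/
theorem isBigO_lower (ht : Tendsto ω atTop (𝓝 w)) :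
    (fun k => F w - l (k + 2)) =O[atTop] fun k => (F w - l k) ^ 2 := by
  have hev : ∀ᶠ k in atTop, |ω k - w| ≤ η :=
    (Metric.tendsto_nhds.1 ht η hs.η_pos).mono fun k hk => hk.le
  refine IsBigO.of_bound (C / c ^ 2) ?_
  filter_upwards [hev, (tendsto_add_atTop_nat 1).eventually hev,
    -- `l 0` is arbitrary, hence `k ≥ 1`.
    (tendsto_add_atTop_nat 2).eventually hev, eventually_ge_atTop 1] with k h0 h1 h2 hk
  obtain ⟨m, rfl⟩ := Nat.exists_eq_add_of_le' hk
  have e1 := hs.add_mul_abs_le_lower hr h0 h1 h2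
  have e2 := hs.lower_le hr (m + 2)
  have e3 := hs.mul_abs_le_sub_lower hr h0
  have e4 := hs.mul_abs_le_sub_lower hr h1
  have e5 := hr.lower_mono m
  have e6 : 0 ≤ c * |ω (m + 1 + 2) - w| := mul_nonneg hs.c_pos.le (abs_nonneg _)
  set D := max |ω (m + 1 + 1) - w| |ω (m + 1) - w|
  have hD0 : 0 ≤ D := (abs_nonneg _).trans (le_max_left _ _)
  have hD : c * D ≤ F w - l (m + 1) := by
    rw [mul_max_of_nonneg _ _ hs.c_pos.le]
    exact max_le (by linarith) e3
  have hD2 : (c * D) ^ 2 ≤ (F w - l (m + 1)) ^ 2 :=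
    pow_le_pow_left₀ (mul_nonneg hs.c_pos.le hD0) hD 2
  rw [Real.norm_of_nonneg (sub_nonneg.2 e2), Real.norm_of_nonneg (sq_nonneg _),
    div_mul_eq_mul_div, le_div_iff₀ (pow_pos hs.c_pos 2)]
  have e7 : F w - l (m + 1 + 2) ≤ C * D ^ 2 := by linarith
  calc (F w - l (m + 1 + 2)) * c ^ 2 ≤ C * D ^ 2 * c ^ 2 := by gcongr
    _ = C * (c * D) ^ 2 := by ring
    _ ≤ C * (F w - l (m + 1)) ^ 2 := mul_le_mul_of_nonneg_left hD2 hs.C_nonneg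

end IsSharpAt

end

/-! ### Convergence, sharpness and assembly -/

/-- The iterates converge to the unique global minimizer. -/
theorem IsRun.tendsto {F : ℝ → ℝ} {a b γ w : ℝ} {ω l : ℕ → ℝ}
    (hr : IsRun F (Set.Icc a b) γ ω l) (hF : ∀ x ∈ Set.Icc a b, IsPiecewiseAnalyticAt F x)
    (hw : w ∈ Set.Icc a b) (hmin : ∀ x ∈ Set.Icc a b, x ≠ w → F w < F x)
    (hle : ∀ j, ∀ x ∈ Set.Icc a b, support F γ (ω j) x ≤ F x) : Tendsto ω atTop (𝓝 w) := by
  refine isCompact_Icc.tendsto_nhds_of_unique_mapClusterPt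
    (Eventually.of_forall hr.mem) fun y hy hcl => ?_
  obtain ⟨ψ, hψ, hψy⟩ := hcl.tendsto_subseq
  by_contra hne
  obtain ⟨L, hL⟩ := (hF y hy).exists_deriv_bound
  -- The later iterate minimizes a model containing the earlier support function. As derivatives are
  -- bounded near `y`, the left side tends to `F y`, so `F y ≤ F w`.
  have hlow : ∀ i, support F γ (ω (ψ i)) (ω (ψ (i + 1))) ≤ F w := by
    intro i
    obtain ⟨m, hm⟩ := Nat.exists_eq_add_of_le' (Nat.one_le_of_lt (hψ i.lt_succ_self))
    have hij : ψ i ≤ m := by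
      have := hψ i.lt_succ_self
      rw [Nat.succ_eq_add_one] at hm this
      omega
    rw [Nat.succ_eq_add_one] at hm
    rw [hm]
    exact (support_le_model hij _).trans ((hr.isMin m hw).trans
      (model_le fun j _ => hle j w hw))
  have hψ1 : Tendsto (fun i => ω (ψ (i + 1))) atTop (𝓝 y) :=
    hψy.comp (tendsto_add_atTop_nat 1)
  have hdiff : Tendsto (fun i => ω (ψ (i + 1)) - ω (ψ i)) atTop (𝓝 0) := by
    simpa using hψ1.sub hψy
  have hder : Tendsto (fun i => deriv F (ω (ψ i)) * (ω (ψ (i + 1)) - ω (ψ i))) atTop (𝓝 0) := by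
    refine bdd_le_mul_tendsto_zero' L ?_ hdiff
    exact (hψy.eventually hL).mono fun i hi => hi (hr.differentiable _)
  have hlim : Tendsto (fun i => support F γ (ω (ψ i)) (ω (ψ (i + 1)))) atTop (𝓝 (F y)) := by
    have h1 : Tendsto (fun i => F (ω (ψ i))) atTop (𝓝 (F y)) :=
      (hF y hy).continuousAt.tendsto.comp hψy
    simpa [support] using (h1.add hder).add ((hdiff.pow 2).const_mul (γ / 2))
  exact absurd (le_of_tendsto' hlim hlow) (not_le.2 (hmin y hy hne))

/-- A sharp minimizer of a piecewise analytic function satisfies the local estimates that drive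
the convergence analysis. -/
theorem exists_isSharpAt {F : ℝ → ℝ} {a b γ w : ℝ} {ω l : ℕ → ℝ}
    (hr : IsRun F (Set.Icc a b) γ ω l) (hF : ∀ x ∈ Set.Icc a b, IsPiecewiseAnalyticAt F x)
    (hγ : IsCurvatureBound F (Set.Icc a b) γ)
    (hw : w ∈ Set.Icc a b) (hmin : ∀ x ∈ Set.Icc a b, x ≠ w → F w < F x)
    (h0 : (0 : ℝ) ∈ interior (clarkeDeriv F w)) :
    ∃ c η C, IsSharpAt F (Set.Icc a b) γ w c η C ω := by
  have hconv := convexOn_sub_sq hF hγ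
  obtain ⟨α, β, C, hα, hβ, hdα, hdβ, hC⟩ := exists_kink (hF w hw) h0
  obtain ⟨r, hr0, hrC⟩ := Metric.eventually_nhds_iff_ball.1 hC
  have hγ0 : 0 < -γ := neg_pos.2 hγ.1
  set μ := min α β
  have hμ : 0 < μ := lt_min hα hβ
  -- Support slopes at `w` are at least `μ` in size; within `η` the curvature changes them by at
  -- most `μ / 2`, leaving `c = μ / 2`. The term `-γ / 2` in the constant pays for the quadratic
  -- part of the support function at `w`.
  set η := min (r / 2) (μ / (2 * -γ))
  have hη : 0 < η := lt_min (by positivity) (by positivity)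
  have hγη : -γ * η ≤ μ / 2 := by
    have : η ≤ μ / (2 * -γ) := min_le_right _ _
    rw [le_div_iff₀ (by positivity)] at this
    linarith
  refine ⟨μ / 2, η, max C 0 - γ / 2, by positivity, hη, by
    linarith [le_max_right C 0], convex_Icc a b, hw, hmin, fun k hk => ?_,
    fun j x hx => support_le hconv (hr.mem j) (hr.differentiable j) hx,
    fun σ hσ j hj x y hx hy hxy => ?_, fun j hj => ?_⟩
  -- `F` is not differentiable at the kink `w`, so no iterate equals `w`.
  · have hd := hr.differentiable k
    rw [hk] at hd
    have e1 := (uniqueDiffWithinAt_Ioi w).eq_deriv _ hd.hasDerivAt.hasDerivWithinAt hdβ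
    have e2 := (uniqueDiffWithinAt_Iio w).eq_deriv _ hd.hasDerivAt.hasDerivWithinAt hdα
    linarith
  · have hslope : μ ≤ σ * (deriv F (ω j) + γ * (w - ω j)) := by
      rcases hσ with rfl | rfl
      · have := le_support_slope_of_right hconv hw hdβ (hr.mem j) (hr.differentiable j)
          (by linarith)
        linarith [min_le_right α β]
      · have := support_slope_le_of_left hconv hw hdα (hr.mem j) (hr.differentiable j)
          (by linarith)
        linarith [min_le_left α β]
    have hσ2 : σ * σ = 1 := by rcases hσ with rfl | rfl <;> norm_num
    have hcurv : -(μ / 2) ≤ σ * (γ * ((x - w) + (y - w)) / 2) := by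
      rw [abs_le] at hx hy
      rcases hσ with rfl | rfl <;> nlinarith
    have hd : 0 ≤ σ * (y - x) := by linarith
    -- The chord slope of a parabola is its slope at the midpoint.
    have key : support F γ (ω j) y - support F γ (ω j) x =
        (σ * (y - x)) * (σ * (deriv F (ω j) + γ * (w - ω j)) +
          σ * (γ * ((x - w) + (y - w)) / 2)) := by
      have : (σ * (y - x)) * (σ * (deriv F (ω j) + γ * (w - ω j)) +
          σ * (γ * ((x - w) + (y - w)) / 2)) = (σ * σ) * ((y - x) *
            (deriv F (ω j) + γ * (w - ω j) + γ * ((x - w) + (y - w)) / 2)) := by ring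
      rw [this, hσ2, support, support]
      ring
    have := mul_le_mul_of_nonneg_left (a := σ * (y - x)) (add_le_add hslope hcurv) hd
    linarith
  · have hball : ω j ∈ Metric.ball w r := by
      rw [Metric.mem_ball, Real.dist_eq]
      exact (hj.trans (min_le_left _ _)).trans_lt (by linarith)
    have h1 := (abs_le.1 (hrC _ hball (hr.differentiable j))).2
    have h2 : C * (w - ω j) ^ 2 ≤ max C 0 * (w - ω j) ^ 2 := by
      gcongr; exact le_max_left _ _
    rw [support, sub_sq_comm (ω j) w]
    linarith

theorem isPiecewiseAnalyticAt_objective {n κ : ℕ} [NeZero n] {f : Fin κ → ℝ → ℝ}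
    {A : Fin κ → Matrix (Fin n) (Fin n) ℂ} (hA : ∀ j, (A j).IsHermitian) {x₀ : ℝ}
    (hf : ∀ j, AnalyticAt ℝ (f j) x₀) : IsPiecewiseAnalyticAt (objective f A) x₀ :=
  ⟨exists_analytic_right hA hf, exists_analytic_left hA hf,
    exists_minorant hA fun j => (hf j).differentiableAt⟩

theorem LamMaxMultiple.neZero {n : ℕ} {M : Matrix (Fin n) (Fin n) ℂ} (h : LamMaxMultiple M) :
    NeZero n := by
  refine ⟨?_⟩
  rintro rfl
  have h' : 2 ≤ Module.finrank ℂ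
      (Module.End.eigenspace (Matrix.toLin' M) ((lamMax M : ℝ) : ℂ)) := h
  rw [Module.finrank_zero_of_subsingleton] at h'
  omega

end EigOpt

theorem theorem3p7 {n κ : ℕ} (A : Fin κ → Matrix (Fin n) (Fin n) ℂ)
    (hA : ∀ j, (A j).IsHermitian)
    (U : Set ℝ) (hUo : IsOpen U) (hUc : U.OrdConnected)
    (f : Fin κ → ℝ → ℝ) (hf : ∀ j, AnalyticOnNhd ℝ (f j) U)
    (a b : ℝ) (hab : Set.Icc a b ⊆ U)
    (w : ℝ) (hw : w ∈ Set.Icc a b)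
    (hmin : ∀ x ∈ Set.Icc a b, x ≠ w → EigOpt.objective f A w < EigOpt.objective f A x)
    (hmult : EigOpt.LamMaxMultiple (EigOpt.family f A w))
    (hclarke : (0 : ℝ) ∈ interior (EigOpt.clarkeDeriv (EigOpt.objective f A) w)) :
    (∀ γ : ℝ, EigOpt.IsCurvatureBound (EigOpt.objective f A) (Set.Icc a b) γ →
      ∀ ω l : ℕ → ℝ, EigOpt.IsRun (EigOpt.objective f A) (Set.Icc a b) γ ω l →
        (∀ᶠ k in atTop,
          (∀ j, EigOpt.IsLeftNearest ω w k j ↔ j = k) ∨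
          (∀ j, EigOpt.IsRightNearest ω w k j ↔ j = k)) ∧
        (fun k => |ω (k + 2) - w|) =O[atTop]
          (fun k => (max |ω (k + 1) - w| |ω k - w|) ^ 2)) ∧
    (∃ Γ : ℝ, ∀ γ : ℝ, Γ ≤ |γ| →
      EigOpt.IsCurvatureBound (EigOpt.objective f A) (Set.Icc a b) γ →
      ∀ ω l : ℕ → ℝ, EigOpt.IsRun (EigOpt.objective f A) (Set.Icc a b) γ ω l →
        (fun k => EigOpt.objective f A w - l (k + 2)) =O[atTop]
          (fun k => (EigOpt.objective f A w - l k) ^ 2)) := by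
  have := hmult.neZero
  have hF : ∀ x ∈ Set.Icc a b, EigOpt.IsPiecewiseAnalyticAt (EigOpt.objective f A) x :=
    fun x hx => EigOpt.isPiecewiseAnalyticAt_objective hA fun j => hf j x (hab hx)
  have main : ∀ γ : ℝ, EigOpt.IsCurvatureBound (EigOpt.objective f A) (Set.Icc a b) γ →
      ∀ ω l : ℕ → ℝ, EigOpt.IsRun (EigOpt.objective f A) (Set.Icc a b) γ ω l →
        Tendsto ω atTop (𝓝 w) ∧
          ∃ c η C, EigOpt.IsSharpAt (EigOpt.objective f A) (Set.Icc a b) γ w c η C ω := by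
    intro γ hγ ω l hr
    obtain ⟨c, η, C, hs⟩ := EigOpt.exists_isSharpAt hr hF hγ hw hmin hclarke
    exact ⟨hr.tendsto hF hw hmin hs.support_le, c, η, C, hs⟩
  -- `Γ = 0` serves, since the gap estimate holds for each curvature bound `γ`.
  refine ⟨fun γ hγ ω l hr => ?_, 0, fun γ _ hγ ω l hr => ?_⟩
  · obtain ⟨ht, c, η, C, hs⟩ := main γ hγ ω l hr
    refine ⟨?_, hs.isBigO_error hr ht⟩
    filter_upwards [Metric.tendsto_nhds.1 ht η hs.η_pos, eventually_ge_atTop 1] with k hk hk1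
    obtain ⟨m, rfl⟩ := Nat.exists_eq_add_of_le' hk1
    exact hs.nearest hr hk.le
  · obtain ⟨ht, c, η, C, hs⟩ := main γ hγ ω l hr
    exact hs.isBigO_lower hr ht
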